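/- Let $\mathbb{F}$ be a field, $X=(x_{i,j})$ an $n\times m$ matrix of variables, and let $I^{\det}_{n,m,r}\subseteq\mathbb{F}[X]$ be the ideal generated by the $r\times r$ minors of $X$. Let $\varepsilon$ be an indeterminate. For a polynomial $P$ with coefficients in $\mathbb{F}((\varepsilon))$ and a polynomial $f$ over $\mathbb{F}$ in the same variables, write $P=f+O(\varepsilon)$ if $P=f+\varepsilon e$ for a polynomial $e$ with coefficients in $\mathbb{F}[[\varepsilon]]$. A layered algebraic branching program (ABP) over a field $K$ is a directed graph whose vertices are arranged in layers, with edges only from one layer to the next, labelled by affine linear polynomials over $K$, with a source in the first layer and a sink in the last layer. It computes the sum over all source–sink paths of the product of the edge labels. A polynomial $g\in\mathbb{F}[\vec y]$ is in the border of layered ABPs with at most $r$ vertices if some layered ABP over $\mathbb{F}((\varepsilon))$ with at most $r$ vertices computes a polynomial $g+O(\varepsilon)$. Let $f\in I^{\det}_{n,m,r}$ be nonzero, let $h(X,\varepsilon)\in\mathbb{F}[[\varepsilon]][X]$ be any polynomial with $h(X,\varepsilon)=f(X)+O(\varepsilon)$, and let $g(\vec y)\in\mathbb{F}[\vec y]$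 be in the border of layered ABPs with at most $r$ vertices. Then there are an integer $N\ge 1$ and a layered depth-three circuit $\Phi$ in the variables $\vec y$, with constants in $\mathbb{F}(\varepsilon)$ and with oracle gates that compute $h(X,\varepsilon^N)$, such that the following hold. 1. The gates of $\Phi$ are exactly $nm$ addition gates in the bottom layer, a single oracle gate in the middle layer, and a single addition gate (the output) in the top layer. Here an addition gate computes an arbitrary affine $\mathbb{F}(\varepsilon)$-linear combination of its inputs. 2. If $\operatorname{char}\mathbb{F}=0$, then $\Phi$ computes $g(\vec y)+O(\varepsilon)$. 3. If $\operatorname{char}\mathbb{F}=p>0$, then $\Phi$ computes $g(\vec y)^{p^k}+O(\varepsilon)$ for some $k\in\mathbb{N}$. -/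

import Mathlib

open scoped PowerSeries LaurentSeries RatFunc

/-! ### Determinantal ideals -/

/-- The ideal of `F[X]`, `X` the generic `n × m` matrix, generated by the `r × r` minors of `X`.
A minor is given by a choice of `r` rows and `r` columns in increasing order. -/
noncomputable def detIdeal (F : Type*) [Field F] (n m r : ℕ) :
    Ideal (MvPolynomial (Fin n × Fin m) F) :=
  Ideal.span {d | ∃ (R : Fin r ↪o Fin n) (C : Fin r ↪o Fin m),
    d = ((Matrix.mvPolynomialX (Fin n) (Fin m) F).submatrix R C).det}

/-! ### Border computation; the indeterminate `ε` is `PowerSeries.X` -/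

/-- `H = f + O(ε)` for `H ∈ F⟦ε⟧[x]` and `f ∈ F[x]`, that is, `H = f + ε e` with
`e ∈ F⟦ε⟧[x]`. -/
def IsApprox {F σ : Type*} [Field F] (H : MvPolynomial σ F⟦X⟧) (f : MvPolynomial σ F) : Prop :=
  ∃ e : MvPolynomial σ F⟦X⟧,
    H = MvPolynomial.map (PowerSeries.C (R := F)) f + MvPolynomial.C PowerSeries.X * e

/-- `P = f + O(ε)` for `P ∈ F((ε))[x]`: the polynomial `P` has all its coefficients in `F⟦ε⟧`,
and it equals `f + O(ε)` there. -/
def BorderComputes {F σ : Type*} [Field F] (P : MvPolynomial σ F⸨X⸩) (f : MvPolynomial σ F) :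
    Prop :=
  ∃ H : MvPolynomial σ F⟦X⟧, P = MvPolynomial.map (HahnSeries.ofPowerSeries ℤ F) H ∧ IsApprox H f

/-- The polynomial `h(x, ε ^ N)` obtained from `h(x, ε) ∈ F⟦ε⟧[x]`. -/
noncomputable def substEpsPow {F σ : Type*} [Field F] (N : ℕ) (hN : N ≠ 0)
    (h : MvPolynomial σ F⟦X⟧) : MvPolynomial σ F⟦X⟧ :=
  MvPolynomial.map (PowerSeries.expand N hN : F⟦X⟧ →ₐ[F] F⟦X⟧).toRingHom h

/-! ### Layered algebraic branching programs -/

/-- A layered algebraic branching program over `K` in the variables `σ` with `s` vertices.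
The vertices are arranged in layers `0, …, depth`; the source is in the first layer and the sink
is in the last one. The label of the edge from `u` to `v` is an affine linear polynomial, and the
label `0` means that there is no edge. Edges go from each layer to the next one. -/
structure LayeredABP (K σ : Type*) [Field K] (s : ℕ) where
  depth : ℕ
  layer : Fin s → Fin (depth + 1)
  source : Fin s
  sink : Fin s
  layer_source : layer source = 0
  layer_sink : layer sink = Fin.last depth
  label : Fin s → Fin s → MvPolynomial σ K
  label_affine : ∀ u v, (label u v).totalDegree ≤ 1
  label_layer : ∀ u v, label u v ≠ 0 → (layer v : ℕ) = layer u + 1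

open Classical in
/-- The polynomial computed by a layered algebraic branching program: the sum over all paths from
the source to the sink of the product of the edge labels. By the layering every such path has
exactly `depth` edges, and vertex sequences that are not paths contribute `0`. -/
noncomputable def LayeredABP.poly {K σ : Type*} [Field K] {s : ℕ} (B : LayeredABP K σ s) :
    MvPolynomial σ K :=
  ∑ p : Fin (B.depth + 1) → Fin s,
    if p 0 = B.source ∧ p (Fin.last B.depth) = B.sink then
      ∏ i : Fin B.depth, B.label (p i.castSucc) (p i.succ)
    else 0

/-- The polynomials in the border of layered algebraic branching programs with at most `r`
vertices. -/
def borderABP (F σ : Type*) [Field F] (r : ℕ) : Set (MvPolynomial σ F) :=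
  {g | ∃ s ≤ r, ∃ B : LayeredABP F⸨X⸩ σ s, BorderComputes B.poly g}

/-! ### Oracle circuits -/

/-- A gate of an oracle circuit over `K`, whose oracle polynomial has the variables `κ`, and which
may read the wires `W`. Scalars on the wires into an addition gate are free. -/
inductive OracleGate (K κ W : Type*) where
  /-- `c + ∑ w ∈ S, a w * w` -/
  | add (c : K) (S : Finset W) (a : W → K)
  /-- the product of the wires in `S` -/
  | mul (S : Multiset W)
  /-- the oracle polynomial evaluated at `args` -/
  | oracle (args : κ → W)

namespace OracleGate

variable {K κ W : Type*}

def IsAdd : OracleGate K κ W → Prop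
  | add _ _ _ => True
  | mul _ => False
  | oracle _ => False

def IsOracle : OracleGate K κ W → Prop
  | add _ _ _ => False
  | mul _ => False
  | oracle _ => True

/-- The wires that a gate reads. -/
def inputs : OracleGate K κ W → Set W
  | add _ S _ => {w | w ∈ S}
  | mul S => {w | w ∈ S}
  | oracle args => Set.range args

/-- The level of a gate is one more than the largest level of the wires that it reads. -/
def level [Fintype κ] (lev : W → ℕ) : OracleGate K κ W → ℕ
  | add _ S _ => S.sup lev + 1
  | mul S => (S.map lev).sup + 1
  | oracle args => (Finset.univ.sup fun k => lev (args k)) + 1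

/-- The polynomial computed at a gate, if `val w` is the polynomial on the wire `w` and `h` is the
oracle polynomial. Both may have coefficients in an extension `L` of the field of constants. -/
noncomputable def value {L σ : Type*} [Field K] [Field L] [Algebra K L] (h : MvPolynomial κ L)
    (val : W → MvPolynomial σ L) : OracleGate K κ W → MvPolynomial σ L
  | add c S a =>
      MvPolynomial.C (algebraMap K L c) + ∑ w ∈ S, MvPolynomial.C (algebraMap K L (a w)) * val w
  | mul S => (S.map val).prod
  | oracle args => MvPolynomial.bind₁ (fun k => val (args k)) h

end OracleGate

/-- An algebraic circuit over `K` in the variables `σ` with oracle gates for a polynomial in the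
variables `κ`. The gates are listed in a topological order: gate `i` may read the variables and the
gates before it. -/
structure OracleCircuit (K σ κ : Type*) where
  size : ℕ
  gate : (i : Fin size) → OracleGate K κ (σ ⊕ Fin (i : ℕ))
  output : Fin size

namespace OracleCircuit

variable {K σ κ : Type*}

/-- The polynomial computed at gate `i` if the oracle gates compute `h`. -/
noncomputable def gateValue {L : Type*} [Field K] [Field L] [Algebra K L]
    (Φ : OracleCircuit K σ κ) (h : MvPolynomial κ L) (i : Fin Φ.size) : MvPolynomial σ L :=
  (Φ.gate i).value h
    (Sum.elim MvPolynomial.X fun j : Fin (i : ℕ) => Φ.gateValue h ⟨j, j.2.trans i.2⟩)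
termination_by (i : ℕ)
decreasing_by exact j.2

/-- The polynomial computed by the circuit if the oracle gates compute `h`. -/
noncomputable def poly {L : Type*} [Field K] [Field L] [Algebra K L]
    (Φ : OracleCircuit K σ κ) (h : MvPolynomial κ L) : MvPolynomial σ L :=
  Φ.gateValue h Φ.output

/-- The level of gate `i`: the length of a longest path that ends in it. Variables have
level `0`. -/
def gateLevel [Fintype κ] (Φ : OracleCircuit K σ κ) (i : Fin Φ.size) : ℕ :=
  (Φ.gate i).level (Sum.elim (fun _ => 0) fun j : Fin (i : ℕ) => Φ.gateLevel ⟨j, j.2.trans i.2⟩)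
termination_by (i : ℕ)
decreasing_by exact j.2

/-- The level of a wire into gate `i`. -/
def wireLevel [Fintype κ] (Φ : OracleCircuit K σ κ) (i : Fin Φ.size) :
    σ ⊕ Fin (i : ℕ) → ℕ :=
  Sum.elim (fun _ => 0) fun j : Fin (i : ℕ) => Φ.gateLevel ⟨j, j.2.trans i.2⟩

/-- The depth of the circuit: the level of its output gate. -/
def depth [Fintype κ] (Φ : OracleCircuit K σ κ) : ℕ := Φ.gateLevel Φ.output

/-- Every wire goes from one level to the next one. -/
def IsLayered [Fintype κ] (Φ : OracleCircuit K σ κ) : Prop :=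
  ∀ i, ∀ w ∈ (Φ.gate i).inputs, Φ.wireLevel i w + 1 = Φ.gateLevel i

/-- The addition gates in layer `l`. -/
def addGates [Fintype κ] (Φ : OracleCircuit K σ κ) (l : ℕ) : Set (Fin Φ.size) :=
  {i | (Φ.gate i).IsAdd ∧ Φ.gateLevel i = l}

/-- The oracle gates in layer `l`. -/
def oracleGates [Fintype κ] (Φ : OracleCircuit K σ κ) (l : ℕ) : Set (Fin Φ.size) :=
  {i | (Φ.gate i).IsOracle ∧ Φ.gateLevel i = l}

/-- A layered depth-three circuit whose gates are exactly: `b` addition gates in the bottom layer,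
one oracle gate in the middle layer, and one addition gate (the output) in the top layer. -/
def IsSumOracleSum [Fintype κ] (Φ : OracleCircuit K σ κ) (b : ℕ) : Prop :=
  Φ.IsLayered ∧ Φ.depth = 3 ∧ Φ.size = b + 2 ∧
    (Φ.addGates 1).ncard = b ∧ (Φ.oracleGates 2).ncard = 1 ∧ (Φ.addGates 3).ncard = 1

end OracleCircuit

/-!
Since the matrix `L` of edge labels of the program is nilpotent, `1 - L` is unitriangular in a
topological order of the vertices. Adding an edge of weight `ε` from the sink to the source gives a
matrix that factors as `(lower unitriangular) * diag(1, …, 1 + ε g, …, 1) * (1 - L)`, with the entry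
`1 + ε g` at the sink. Multiplying the matrix by `diag(ε ^ (G w i))` on both sides, for increasing
weights `w` and a large `G`, and moving these powers of `ε` to the middle factor brings both
triangular factors as close to the identity as desired. The entries of the product stay affine
linear.

Substituting `A * D * B` for `X` in `f`, with `D` diagonal and `A`, `B` generic, only monomials in
at least `r` of the entries of `D` occur, because the `r × r` minors vanish on matrices of smaller
rank. For generic weights a single monomial dominates as `ε` tends to `0`, and the program fits into
the indices up to one that occurs in this monomial. Placing the sink there, `f` takes a value close
to a constant times `(1 + ε g) ^ k` with `k ≠ 0`. If `q` is the characteristic exponent and `q ^ a`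
the exact power of it in `k`, then `(1 + ε g) ^ k = 1 + k' ε ^ (q ^ a) g ^ (q ^ a) + ⋯`
with `k' ≠ 0`, so an affine function of the value approximates `g ^ (q ^ a)`. Only finitely
many terms in `ε` matter: the Laurent series may be truncated to rational functions, and `h` may be
evaluated at a large power of `ε` so that it behaves like `f`.
-/

open MvPolynomial

section EpsBigO

variable {F σ : Type*} [Field F]

/-- The constant polynomial `ε ^ k` over `F((ε))`. -/
noncomputable def epsPow (k : ℤ) : MvPolynomial σ F⸨X⸩ :=
  C (HahnSeries.single k 1)

theorem epsPow_zero : (epsPow 0 : MvPolynomial σ F⸨X⸩) = 1 := rfl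

theorem epsPow_add (j k : ℤ) :
    (epsPow (j + k) : MvPolynomial σ F⸨X⸩) = epsPow j * epsPow k := by
  rw [epsPow, epsPow, epsPow, ← map_mul, HahnSeries.single_mul_single, one_mul]

theorem epsPow_mul_natCast (k : ℤ) (n : ℕ) :
    (epsPow (k * n) : MvPolynomial σ F⸨X⸩) = epsPow k ^ n := by
  rw [epsPow, epsPow, ← map_pow, HahnSeries.single_pow, one_pow, nsmul_eq_mul, mul_comm]

theorem epsPow_sum {ι : Type*} (s : Finset ι) (k : ι → ℤ) :
    (epsPow (∑ i ∈ s, k i) : MvPolynomial σ F⸨X⸩) = ∏ i ∈ s, epsPow (k i) := by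
  classical
  induction s using Finset.induction_on with
  | empty => exact epsPow_zero
  | insert i s hi ih => rw [Finset.sum_insert hi, Finset.prod_insert hi, epsPow_add, ih]

/-- The additive group `ε ^ k F⟦ε⟧[x]` of the polynomials over `F((ε))` that are `O(ε ^ k)`. -/
noncomputable def epsBigO (k : ℤ) : AddSubgroup (MvPolynomial σ F⸨X⸩) :=
  ((AddMonoidHom.mulLeft (epsPow k)).comp
    (map (HahnSeries.ofPowerSeries ℤ F)).toAddMonoidHom).range

theorem mem_epsBigO {k : ℤ} {P : MvPolynomial σ F⸨X⸩} :
    P ∈ epsBigO k ↔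
      ∃ Q : MvPolynomial σ F⟦X⟧, epsPow k * map (HahnSeries.ofPowerSeries ℤ F) Q = P :=
  Iff.rfl

theorem map_ofPowerSeries_mem_epsBigO_zero (Q : MvPolynomial σ F⟦X⟧) :
    map (HahnSeries.ofPowerSeries ℤ F) Q ∈ epsBigO 0 :=
  ⟨Q, one_mul _⟩

theorem one_mem_epsBigO_zero : (1 : MvPolynomial σ F⸨X⸩) ∈ epsBigO 0 := by
  simpa only [map_one] using map_ofPowerSeries_mem_epsBigO_zero (1 : MvPolynomial σ F⟦X⟧)

theorem epsPow_mem_epsBigO (k : ℤ) : (epsPow k : MvPolynomial σ F⸨X⸩) ∈ epsBigO k :=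
  mem_epsBigO.2 ⟨1, by rw [map_one, mul_one]⟩

theorem mul_mem_epsBigO {j k : ℤ} {P Q : MvPolynomial σ F⸨X⸩} (hP : P ∈ epsBigO j)
    (hQ : Q ∈ epsBigO k) : P * Q ∈ epsBigO (j + k) := by
  obtain ⟨P', rfl⟩ := mem_epsBigO.1 hP
  obtain ⟨Q', rfl⟩ := mem_epsBigO.1 hQ
  exact mem_epsBigO.2 ⟨P' * Q', by rw [epsPow_add, map_mul]; ring⟩

theorem matrix_mul_apply_mem_epsBigO {ι κ μ : Type*} [Fintype κ] {j k : ℤ}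
    {A : Matrix ι κ (MvPolynomial σ F⸨X⸩)} {B : Matrix κ μ (MvPolynomial σ F⸨X⸩)}
    (hA : ∀ x y, A x y ∈ epsBigO j) (hB : ∀ x y, B x y ∈ epsBigO k) (x : ι) (y : μ) :
    (A * B) x y ∈ epsBigO (j + k) :=
  sum_mem fun z _ => mul_mem_epsBigO (hA x z) (hB z y)

theorem epsBigO_anti {j k : ℤ} (h : j ≤ k) :
    (epsBigO k : AddSubgroup (MvPolynomial σ F⸨X⸩)) ≤ epsBigO j := by
  obtain ⟨d, rfl⟩ := Int.exists_add_of_le h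
  rintro _ ⟨Q, rfl⟩
  refine mem_epsBigO.2 ⟨C (PowerSeries.X ^ d) * Q, ?_⟩
  rw [map_mul, map_C, HahnSeries.ofPowerSeries_X_pow, ← mul_assoc]
  exact congrArg (· * _) (epsPow_add j d).symm

theorem mem_epsBigO_zero_of_sub_mem {P Q : MvPolynomial σ F⸨X⸩} {k : ℕ} (hQ : Q ∈ epsBigO 0)
    (hPQ : P - Q ∈ epsBigO k) : P ∈ epsBigO 0 := by
  simpa only [sub_add_cancel] using add_mem (epsBigO_anti (Int.natCast_nonneg k) hPQ) hQ

theorem one_add_epsPow_one_mul_mem_epsBigO_zero {P : MvPolynomial σ F⸨X⸩} (hP : P ∈ epsBigO 0) :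
    1 + epsPow 1 * P ∈ epsBigO 0 :=
  add_mem one_mem_epsBigO_zero
    (epsBigO_anti (by norm_num) (mul_mem_epsBigO (epsPow_mem_epsBigO 1) hP))

theorem exists_mem_epsBigO_neg (P : MvPolynomial σ F⸨X⸩) : ∃ D : ℕ, P ∈ epsBigO (-D) := by
  induction P using MvPolynomial.induction_on with
  | C a =>
    have ha : C a ∈ epsBigO (σ := σ) a.order := mem_epsBigO.2
      ⟨C a.powerSeriesPart, by rw [map_C, epsPow, ← map_mul, a.single_order_mul_powerSeriesPart]⟩
    exact ⟨a.order.natAbs, epsBigO_anti (by omega) ha⟩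
  | add P Q hP hQ =>
    obtain ⟨D, hP⟩ := hP
    obtain ⟨E, hQ⟩ := hQ
    exact ⟨max D E, add_mem (epsBigO_anti (by omega) hP) (epsBigO_anti (by omega) hQ)⟩
  | mul_X P i hP =>
    obtain ⟨D, hP⟩ := hP
    have hX : (X i : MvPolynomial σ F⸨X⸩) ∈ epsBigO 0 := by
      simpa only [map_X] using map_ofPowerSeries_mem_epsBigO_zero (X i)
    exact ⟨D, by simpa only [add_zero] using mul_mem_epsBigO hP hX⟩

theorem exists_forall_mem_epsBigO_neg {ι : Type*} [Finite ι] (P : ι → MvPolynomial σ F⸨X⸩) :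
    ∃ D : ℕ, ∀ i, P i ∈ epsBigO (-D) := by
  have := Fintype.ofFinite ι
  choose D hD using fun i => exists_mem_epsBigO_neg (P i)
  refine ⟨Finset.univ.sup D, fun i => epsBigO_anti ?_ (hD i)⟩
  exact neg_le_neg (Int.ofNat_le.2 (Finset.le_sup (Finset.mem_univ i)))

theorem eval₂_mem_epsBigO_zero {R τ : Type*} [CommSemiring R] {φ : R →+* MvPolynomial σ F⸨X⸩}
    (hφ : ∀ a, φ a ∈ epsBigO 0) {x : τ → MvPolynomial σ F⸨X⸩} (hx : ∀ i, x i ∈ epsBigO 0)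
    (c : MvPolynomial τ R) : eval₂ φ x c ∈ epsBigO 0 := by
  induction c using MvPolynomial.induction_on with
  | C a => simpa only [eval₂_C] using hφ a
  | add c d hc hd => simpa only [eval₂_add] using add_mem hc hd
  | mul_X c i hc => simpa only [eval₂_mul, eval₂_X, add_zero] using mul_mem_epsBigO hc (hx i)

theorem eval₂_sub_eval₂_mem_epsBigO {R τ : Type*} [CommSemiring R]
    {φ : R →+* MvPolynomial σ F⸨X⸩} (hφ : ∀ a, φ a ∈ epsBigO 0)
    {x y : τ → MvPolynomial σ F⸨X⸩} (hx : ∀ i, x i ∈ epsBigO 0) (hy : ∀ i, y i ∈ epsBigO 0)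
    {k : ℤ} (hxy : ∀ i, x i - y i ∈ epsBigO k) (c : MvPolynomial τ R) :
    eval₂ φ x c - eval₂ φ y c ∈ epsBigO k := by
  induction c using MvPolynomial.induction_on with
  | C a => simp only [eval₂_C, sub_self, zero_mem]
  | add c d hc hd => simpa only [eval₂_add, add_sub_add_comm] using add_mem hc hd
  | mul_X c i hc =>
    have hsplit : eval₂ φ x (c * X i) - eval₂ φ y (c * X i) =
        (eval₂ φ x c - eval₂ φ y c) * x i + eval₂ φ y c * (x i - y i) := by
      simp only [eval₂_mul, eval₂_X]
      ring
    rw [hsplit]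
    refine add_mem ?_ ?_
    · simpa only [add_zero] using mul_mem_epsBigO hc (hx i)
    · simpa only [zero_add] using mul_mem_epsBigO (eval₂_mem_epsBigO_zero hφ hy c) (hxy i)

theorem pow_sub_pow_mem_epsBigO {k : ℤ} {P Q : MvPolynomial σ F⸨X⸩} (hP : P ∈ epsBigO 0)
    (hQ : Q ∈ epsBigO 0) (hPQ : P - Q ∈ epsBigO k) (n : ℕ) : P ^ n - Q ^ n ∈ epsBigO k := by
  simpa only [eval₂_pow, eval₂_X] using eval₂_sub_eval₂_mem_epsBigO (τ := Unit)
    map_ofPowerSeries_mem_epsBigO_zero (fun _ => hP) (fun _ => hQ) (fun _ => hPQ) (X () ^ n)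

theorem map_ofPowerSeries_map_C (f : MvPolynomial σ F) :
    map (HahnSeries.ofPowerSeries ℤ F) (map (PowerSeries.C (R := F)) f) =
      map (algebraMap F F⸨X⸩) f := by
  rw [map_map]
  congr 1

theorem map_algebraMap_mem_epsBigO_zero (f : MvPolynomial σ F) :
    map (algebraMap F F⸨X⸩) f ∈ epsBigO 0 :=
  map_ofPowerSeries_map_C f ▸ map_ofPowerSeries_mem_epsBigO_zero _

theorem algebraMap_mem_epsBigO_zero (a : F) :
    algebraMap F (MvPolynomial σ F⸨X⸩) a ∈ epsBigO 0 := by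
  simpa only [map_C, MvPolynomial.algebraMap_apply] using
    map_algebraMap_mem_epsBigO_zero (σ := σ) (C a)

theorem aeval_mem_epsBigO_zero {κ : Type*} {x : κ → MvPolynomial σ F⸨X⸩}
    (hx : ∀ i, x i ∈ epsBigO 0) (c : MvPolynomial κ F) : aeval x c ∈ epsBigO 0 :=
  eval₂_mem_epsBigO_zero algebraMap_mem_epsBigO_zero hx c

theorem aeval_sub_aeval_mem_epsBigO {κ : Type*} {x y : κ → MvPolynomial σ F⸨X⸩} {k : ℤ}
    (hx : ∀ i, x i ∈ epsBigO 0) (hy : ∀ i, y i ∈ epsBigO 0) (hxy : ∀ i, x i - y i ∈ epsBigO k)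
    (c : MvPolynomial κ F) : aeval x c - aeval y c ∈ epsBigO k :=
  eval₂_sub_eval₂_mem_epsBigO algebraMap_mem_epsBigO_zero hx hy hxy c

theorem borderComputes_iff {P : MvPolynomial σ F⸨X⸩} {f : MvPolynomial σ F} :
    BorderComputes P f ↔ P - map (algebraMap F F⸨X⸩) f ∈ epsBigO 1 := by
  have hX (e : MvPolynomial σ F⟦X⟧) : map (HahnSeries.ofPowerSeries ℤ F) (C PowerSeries.X * e) =
      epsPow 1 * map (HahnSeries.ofPowerSeries ℤ F) e := by
    rw [map_mul, map_C, HahnSeries.ofPowerSeries_X, epsPow]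
  constructor
  · rintro ⟨_, rfl, e, rfl⟩
    exact ⟨e, by rw [map_add, map_ofPowerSeries_map_C, hX, add_sub_cancel_left]; rfl⟩
  · rintro ⟨e, he⟩
    refine ⟨_, ?_, e, rfl⟩
    rw [map_add, map_ofPowerSeries_map_C, hX]
    exact (add_eq_of_eq_sub' he).symm

end EpsBigO

section DetIdeal

variable {F : Type*} [Field F]

theorem aeval_mul_eq_zero_of_mem_detIdeal {S J : Type*} [CommRing S] [IsDomain S] [Algebra F S]
    [Fintype J] {n m r : ℕ} {f : MvPolynomial (Fin n × Fin m) F} (hf : f ∈ detIdeal F n m r)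
    (hJ : Fintype.card J < r) (A : Matrix (Fin n) J S) (B : Matrix J (Fin m) S) :
    aeval (fun x => (A * B) x.1 x.2) f = 0 := by
  suffices hker : detIdeal F n m r ≤
      RingHom.ker (aeval (R := F) fun x : Fin n × Fin m => (A * B) x.1 x.2) from hker hf
  refine Ideal.span_le.2 ?_
  rintro _ ⟨R, C, rfl⟩
  have hminor : (aeval (R := F) fun x => (A * B) x.1 x.2).mapMatrix
      ((Matrix.mvPolynomialX (Fin n) (Fin m) F).submatrix R C) =
        A.submatrix R id * B.submatrix id C := by
    rw [← Matrix.submatrix_mul _ _ _ _ _ Function.bijective_id]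
    ext i j
    simp only [AlgHom.mapMatrix_apply, Matrix.map_apply, Matrix.submatrix_apply,
      Matrix.mvPolynomialX_apply, aeval_X]
  rw [SetLike.mem_coe, RingHom.mem_ker, AlgHom.map_det, hminor]
  by_contra hdet
  have hrank := Matrix.rank_of_det_ne_zero hdet
  rw [Fintype.card_fin] at hrank
  exact (hrank.symm.trans_le ((Matrix.rank_mul_le_left _ _).trans
    (Matrix.rank_le_card_width _))).not_gt hJ

theorem nonempty_of_mem_detIdeal {n m r : ℕ} {f : MvPolynomial (Fin n × Fin m) F}
    (hf : f ∈ detIdeal F n m r) (hf0 : f ≠ 0) (hr : 0 < r) : Nonempty (Fin n × Fin m) := by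
  by_contra hempty
  rw [not_nonempty_iff] at hempty
  refine hf0 ?_
  have hzero := aeval_mul_eq_zero_of_mem_detIdeal (J := Empty)
    (S := MvPolynomial (Fin n × Fin m) F) hf (by simpa using hr) 0 0
  rwa [Subsingleton.elim (fun x : Fin n × Fin m => _) X, aeval_X_left_apply] at hzero

/-- The polynomial `f (A diag(d) B)` in the variables `d`, for generic matrices `A` and `B`. -/
noncomputable def genericDiag {ι μ : Type*} (κ : Type*) [Fintype κ] (f : MvPolynomial (ι × μ) F) :
    MvPolynomial κ (MvPolynomial ((ι × κ) ⊕ (κ × μ)) F) :=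
  aeval (fun x => ∑ k, C (X (Sum.inl (x.1, k)) * X (Sum.inr (k, x.2))) * X k) f

variable {ι κ μ : Type*} [Fintype κ]

theorem eval₂_genericDiag [DecidableEq κ] {S : Type*} [CommRing S] [Algebra F S]
    (A : Matrix ι κ S) (d : κ → S) (B : Matrix κ μ S) (f : MvPolynomial (ι × μ) F) :
    eval₂ (aeval (R := F) (Sum.elim (Function.uncurry A) (Function.uncurry B))).toRingHom d
      (genericDiag κ f) = aeval (fun x => (A * Matrix.diagonal d * B) x.1 x.2) f := by
  refine (hom_eval₂ f _ (eval₂Hom _ d) _).trans ?_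
  rw [aeval_def]
  congr 1
  · refine RingHom.ext fun c => (eval₂_C _ _ _).trans ?_
    exact AlgHom.commutes (aeval _) c
  · funext x
    rw [Matrix.mul_apply, map_sum]
    refine Finset.sum_congr rfl fun k _ => ?_
    rw [Matrix.mul_diagonal, mul_right_comm]
    simp only [AlgHom.toRingHom_eq_coe, map_mul, coe_eval₂Hom, eval₂_C, eval₂_X, RingHom.coe_coe,
      aeval_X, Sum.elim_inl, Sum.elim_inr]
    rfl

theorem genericDiag_ne_zero {f : MvPolynomial (κ × μ) F} (hf : f ≠ 0) : genericDiag κ f ≠ 0 := by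
  classical
  intro hzero
  have h := eval₂_genericDiag (1 : Matrix κ κ _) 1
    (Matrix.of fun k j => (X (k, j) : MvPolynomial (κ × μ) F)) f
  rw [hzero, eval₂_zero, Matrix.one_mul] at h
  simp only [Matrix.diagonal_one', Matrix.one_mul, Matrix.of_apply, Prod.mk.eta] at h
  exact hf (h.trans (aeval_X_left_apply f)).symm

theorem killCompl_genericDiag (J : Finset κ) (f : MvPolynomial (ι × μ) F) :
    killCompl (Subtype.val_injective (p := (· ∈ J))) (genericDiag κ f) =
      aeval (fun x => ∑ k : J, C (X (Sum.inl (x.1, k.1)) * X (Sum.inr (k.1, x.2))) * X k) f := by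
  rw [genericDiag, ← AlgHom.coe_restrictScalars' F, ← AlgHom.comp_apply, comp_aeval]
  refine congrArg (fun y => aeval y f) (funext fun x => ?_)
  rw [AlgHom.coe_restrictScalars', map_sum]
  refine (Fintype.sum_of_injective Subtype.val Subtype.val_injective _ _ ?_ ?_).symm
  · intro k hk
    rw [map_mul, killCompl, aeval_X, dif_neg hk, mul_zero]
  · intro k
    rw [map_mul (killCompl _), killCompl_C, ← rename_X Subtype.val k, killCompl_rename_app]

theorem le_card_support_of_mem_support_genericDiag {n m r : ℕ}
    {f : MvPolynomial (Fin n × Fin m) F} (hf : f ∈ detIdeal F n m r) {α : κ →₀ ℕ}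
    (hα : α ∈ (genericDiag κ f).support) : r ≤ α.support.card := by
  by_contra! hlt
  let R := MvPolynomial ((Fin n × κ) ⊕ (κ × Fin m)) F
  have hkill : killCompl (Subtype.val_injective (p := (· ∈ α.support))) (genericDiag κ f) = 0 := by
    rw [killCompl_genericDiag]
    have hzero := aeval_mul_eq_zero_of_mem_detIdeal hf
      ((Fintype.card_coe α.support).trans_lt hlt)
      (Matrix.of fun i k => (C (X (Sum.inl (i, k.1)) : R) * X k))
      (Matrix.of fun k j => (C (X (Sum.inr (k.1, j)) : R)))
    simpa only [Matrix.mul_apply, Matrix.of_apply, map_mul, mul_right_comm] using hzero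
  have hα' : Finsupp.mapDomain Subtype.val (α.comapDomain _ Subtype.val_injective.injOn) = α :=
    α.mapDomain_comapDomain _ (Subtype.val_injective (p := (· ∈ α.support)))
      Subtype.range_coe.superset
  rw [mem_support_iff, ← hα', ← coeff_killCompl Subtype.val_injective, hkill, coeff_zero] at hα
  exact hα rfl

end DetIdeal

theorem matrix_pow_apply_eq_sum_walks {R V : Type*} [CommSemiring R] [Fintype V] [DecidableEq V]
    (A : Matrix V V R) (d : ℕ) (u v : V) :
    (A ^ d) u v = ∑ p : Fin (d + 1) → V,
      if p 0 = u ∧ p (Fin.last d) = v then ∏ i : Fin d, A (p i.castSucc) (p i.succ) else 0 := by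
  induction d generalizing u with
  | zero =>
    rw [← (Equiv.funUnique (Fin 1) V).symm.sum_comp]
    simp [Matrix.one_apply, ite_and]
  | succ d ih =>
    rw [pow_succ', Matrix.mul_apply]
    symm
    rw [← (Fin.consEquiv fun _ : Fin (d + 2) => V).sum_comp, Fintype.sum_prod_type,
      Fintype.sum_eq_single u fun w hw => by simp [hw]]
    simp only [ih, Finset.mul_sum, Fin.consEquiv_apply, Fin.cons_zero, true_and, ← Fin.succ_last,
      Fin.cons_succ, Fin.prod_univ_succ, Fin.castSucc_zero, ← Fin.succ_castSucc]
    rw [Finset.sum_comm]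
    refine Finset.sum_congr rfl fun p _ => ?_
    rw [Fintype.sum_eq_single (p 0) fun w hw => by simp [hw.symm]]
    simp

theorem exists_embedding_lt_of_lt {s n : ℕ} (key : Fin s → ℕ) {z : Fin s}
    (hz : ∀ u, u ≠ z → key u < key z) {p : Fin n} (hp : s ≤ p + 1) :
    ∃ ι : Fin s ↪ Fin n, (∀ u v, key u < key v → ι u < ι v) ∧ ι z = p := by
  let pos : Equiv.Perm (Fin s) := (Tuple.sort key).symm
  have hpos (u v) (huv : key u < key v) : pos u < pos v := by
    by_contra! h
    have hle := Tuple.monotone_sort key h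
    simp only [Function.comp_apply, pos, Equiv.apply_symm_apply] at hle
    exact hle.not_gt huv
  have hlast : (pos z : ℕ) + 1 = s := by
    let t : Fin s := ⟨s - 1, Nat.sub_one_lt z.pos.ne'⟩
    have hzt : pos z = t := by
      by_contra hne
      have hlt := hpos _ _ (hz (pos.symm t) fun h => hne (h ▸ pos.apply_symm_apply t))
      rw [pos.apply_symm_apply, Fin.lt_def] at hlt
      have := (pos z).2
      grind
    grind
  refine ⟨⟨fun u => ⟨pos u + (p + 1 - s), by grind⟩, fun u v huv => ?_⟩, fun u v huv => ?_, ?_⟩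
  · exact pos.injective (Fin.ext (Nat.add_right_cancel (congrArg Fin.val huv)))
  · exact Nat.add_lt_add_right (hpos u v huv) _
  · exact Fin.ext (show (pos z : ℕ) + (p + 1 - s) = p by omega)

theorem one_submatrix_mul_transpose {R ι κ : Type*} [CommSemiring R] [DecidableEq ι] [Fintype κ]
    [DecidableEq κ] (φ : ι ↪ κ) :
    (1 : Matrix κ κ R).submatrix φ id * ((1 : Matrix κ κ R).submatrix φ id).transpose = 1 := by
  rw [Matrix.transpose_submatrix, Matrix.transpose_one,
    ← Matrix.submatrix_mul _ _ _ _ _ Function.bijective_id, Matrix.one_mul,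
    Matrix.submatrix_one_embedding]

theorem transpose_one_submatrix_mul_mul_apply {R ι κ : Type*} [CommSemiring R] [Fintype ι]
    [DecidableEq κ] (φ : ι → κ) (L : Matrix ι ι R) (i j : κ) :
    (((1 : Matrix κ κ R).submatrix φ id).transpose * L * (1 : Matrix κ κ R).submatrix φ id :
      Matrix κ κ R) i j = ∑ v, ∑ u, if φ u = i ∧ φ v = j then L u v else 0 := by
  simp [Matrix.mul_apply, Matrix.one_apply, ite_and, Finset.sum_ite, eq_comm]

namespace LayeredABP

variable {K σ : Type*} [Field K] {s : ℕ} (B : LayeredABP K σ s)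

variable {B} in
theorem layer_eq_of_label_pow_apply_ne_zero {k : ℕ} {u v : Fin s}
    (h : (Matrix.of B.label ^ k) u v ≠ 0) : (B.layer v : ℕ) = B.layer u + k := by
  induction k generalizing v with
  | zero =>
    rw [pow_zero, Matrix.one_apply] at h
    rw [(ite_ne_right_iff.1 h).1, add_zero]
  | succ k ih =>
    rw [pow_succ, Matrix.mul_apply] at h
    obtain ⟨w, _, hw⟩ := Finset.exists_ne_zero_of_sum_ne_zero h
    rw [B.label_layer w v (right_ne_zero_of_mul hw), ih (left_ne_zero_of_mul hw), add_assoc]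

/-- The matrix whose entry at `(u, v)` is the sum over all paths from `u` to `v` of the product of
the edge labels. The layering bounds the length of a path by `B.depth`. -/
noncomputable def pathSum : Matrix (Fin s) (Fin s) (MvPolynomial σ K) :=
  ∑ k ∈ Finset.range (B.depth + 1), Matrix.of B.label ^ k

theorem pathSum_mul_one_sub_label : B.pathSum * (1 - Matrix.of B.label) = 1 := by
  have hnil : Matrix.of B.label ^ (B.depth + 1) = 0 := by
    ext u v : 1
    by_contra h
    have := layer_eq_of_label_pow_apply_ne_zero h
    have := (B.layer v).2
    omega
  rw [pathSum, geom_sum_mul_neg, hnil, sub_zero]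

theorem pathSum_source_sink : B.pathSum B.source B.sink = B.poly := by
  rw [pathSum, Matrix.sum_apply, Finset.sum_eq_single_of_mem B.depth (Finset.self_mem_range_succ _)]
  · rw [matrix_pow_apply_eq_sum_walks, poly]
    exact Finset.sum_congr rfl fun w _ => by congr!
  · intro k _ hk
    by_contra h
    have hlayer := layer_eq_of_label_pow_apply_ne_zero h
    rw [B.layer_source, B.layer_sink, Fin.val_last, Fin.val_zero, zero_add] at hlayer
    exact hk hlayer.symm

theorem exists_embedding_lt_of_label_ne_zero {n : ℕ} {p : Fin n} (hp : s ≤ p + 1) :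
    ∃ ι : Fin s ↪ Fin n, (∀ u v, B.label u v ≠ 0 → ι u < ι v) ∧ (∀ u, ι u ≤ p) ∧
      ι B.sink = p := by
  -- The layer, with ties in the last layer broken in favour of the sink.
  let key (u : Fin s) : ℕ := 2 * B.layer u + if u = B.sink then 1 else 0
  have hsink (u : Fin s) (hu : u ≠ B.sink) : key u < key B.sink := by
    have hu' : (B.layer u : ℕ) ≤ B.layer B.sink := by
      rw [B.layer_sink]
      exact Fin.le_last _
    simp only [key, if_neg hu, if_true]
    omega
  obtain ⟨ι, hι, hιp⟩ := exists_embedding_lt_of_lt key hsink hp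
  refine ⟨ι, fun u v huv => hι u v ?_, fun u => ?_, hιp⟩
  · have hlayer := B.label_layer u v huv
    simp only [key]
    split_ifs <;> omega
  · rcases eq_or_ne u B.sink with rfl | hu
    · exact hιp.le
    · exact hιp ▸ (hι u _ (hsink u hu)).le

-- `A` is the matrix of labels for a topological order with the sink at `p`, and `q` is the row of
-- `(1 - A)⁻¹` at the source `o`.
theorem exists_strictUpper {n : ℕ} {p : Fin n} (hp : s ≤ p + 1) :
    ∃ (A : Matrix (Fin n) (Fin n) (MvPolynomial σ K)) (o : Fin n) (q : Fin n → MvPolynomial σ K),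
      (∀ i j, A i j ≠ 0 → i < j) ∧ (∀ i j, (A i j).totalDegree ≤ 1) ∧
        Matrix.vecMul q (1 - A) = Pi.single o 1 ∧ q p = B.poly ∧ ∀ j, p < j → q j = 0 := by
  obtain ⟨ι, hι, hιp, hsink⟩ := B.exists_embedding_lt_of_label_ne_zero hp
  let L : Matrix (Fin s) (Fin s) (MvPolynomial σ K) := Matrix.of B.label
  let P : Matrix (Fin s) (Fin n) (MvPolynomial σ K) := (1 : Matrix _ _ _).submatrix ι id
  have hP (u : Fin s) (j : Fin n) : P u j = if ι u = j then 1 else 0 := Matrix.one_apply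
  refine ⟨P.transpose * L * P, ι B.source, (B.pathSum * P) B.source, ?_, ?_, ?_, ?_, ?_⟩
  · intro i j h
    rw [transpose_one_submatrix_mul_mul_apply] at h
    obtain ⟨v, _, hv⟩ := Finset.exists_ne_zero_of_sum_ne_zero h
    obtain ⟨u, _, hu⟩ := Finset.exists_ne_zero_of_sum_ne_zero hv
    obtain ⟨⟨rfl, rfl⟩, huv⟩ := ite_ne_right_iff.1 hu
    exact hι u v huv
  · intro i j
    rw [transpose_one_submatrix_mul_mul_apply]
    refine totalDegree_finsetSum_le fun v _ => totalDegree_finsetSum_le fun u _ => ?_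
    split_ifs
    · exact B.label_affine u v
    · rw [totalDegree_zero]
      exact zero_le_one
  · have hQ : B.pathSum * P * (1 - P.transpose * L * P) = P := by
      calc B.pathSum * P * (1 - P.transpose * L * P)
          = B.pathSum * P - B.pathSum * (P * P.transpose) * L * P := by
            simp only [Matrix.mul_sub, Matrix.mul_one, Matrix.mul_assoc]
        _ = B.pathSum * (1 - L) * P := by
            rw [one_submatrix_mul_transpose, Matrix.mul_one, Matrix.mul_sub, Matrix.mul_one,
              Matrix.sub_mul]
        _ = P := by rw [pathSum_mul_one_sub_label, Matrix.one_mul]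
    rw [← Matrix.mul_apply_eq_vecMul, hQ]
    funext j
    simp [hP, Pi.single_apply, eq_comm]
  · simp [Matrix.mul_apply, hP, ← hsink, ι.injective.eq_iff, pathSum_source_sink]
  · intro j hj
    have hne (u : Fin s) : ι u ≠ j := ((hιp u).trans_lt hj).ne
    simp [Matrix.mul_apply, hP, hne]

end LayeredABP

section Factorization

theorem one_add_vecMulVec_single_mul {S ι : Type*} [CommRing S] [Fintype ι] [DecidableEq ι]
    {T : Matrix ι ι S} {q : ι → S} {o : ι} (hT : Matrix.vecMul q T = Pi.single o 1) (p : ι)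
    (c : S) :
    (1 + Matrix.vecMulVec (Pi.single p c) q) * T = T + Matrix.single p o c := by
  rw [add_mul, one_mul, Matrix.vecMulVec_mul, hT, ← mul_one c, ← smul_eq_mul, Pi.single_smul,
    Matrix.smul_vecMulVec, ← Matrix.single_eq_single_vecMulVec_single, Matrix.smul_single]

theorem one_add_vecMulVec_single_eq_mul_diagonal {S ι : Type*} [CommRing S] [Fintype ι]
    [DecidableEq ι] (q : ι → S) (p : ι) (c : S) :
    1 + Matrix.vecMulVec (Pi.single p c) q =
      (1 + Matrix.vecMulVec (Pi.single p c) (Function.update q p 0)) *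
        Matrix.diagonal (Function.update 1 p (1 + c * q p)) := by
  ext i j
  rw [Matrix.mul_diagonal]
  simp only [Matrix.add_apply, Matrix.vecMulVec_apply, Matrix.one_apply, Pi.single_apply,
    Function.update_apply, Pi.one_apply]
  by_cases hi : i = p <;> by_cases hj : j = p <;> simp [hi, hj]

theorem exists_one_add_mul_diagonal_mul_one_sub_eq {S : Type*} [CommRing S] {n : ℕ}
    {A : Matrix (Fin n) (Fin n) S} {o p : Fin n} {q : Fin n → S}
    (hqA : Matrix.vecMul q (1 - A) = Pi.single o 1) (hq : ∀ j, p < j → q j = 0) (c : S) :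
    ∃ E : Matrix (Fin n) (Fin n) S, (∀ i j, E i j ≠ 0 → j < i) ∧
      (1 + E) * Matrix.diagonal (Function.update 1 p (1 + c * q p)) * (1 - A) =
        1 - A + Matrix.single p o c := by
  refine ⟨Matrix.vecMulVec (Pi.single p c) (Function.update q p 0), fun i j hij => ?_, ?_⟩
  · rw [Matrix.vecMulVec_apply, Pi.single_apply, Function.update_apply] at hij
    by_contra! hle
    grind
  · rw [← one_add_vecMulVec_single_eq_mul_diagonal, one_add_vecMulVec_single_mul hqA]

variable {F σ : Type*} [Field F]

theorem totalDegree_map_C_mul_mul_map_C_apply_le {K ι κ μ : Type*} [CommSemiring K] [Fintype κ]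
    (A : Matrix ι κ K) {N : Matrix κ κ (MvPolynomial σ K)} (B : Matrix κ μ K) {d : ℕ}
    (hN : ∀ i j, (N i j).totalDegree ≤ d) (i : ι) (j : μ) :
    ((A.map (C (σ := σ)) * N * B.map (C (σ := σ))) i j).totalDegree ≤ d := by
  simp only [Matrix.mul_apply, Matrix.map_apply]
  refine totalDegree_finsetSum_le fun k _ => (totalDegree_mul _ _).trans ?_
  rw [totalDegree_C, add_zero]
  refine totalDegree_finsetSum_le fun k' _ => (totalDegree_mul _ _).trans ?_
  rw [totalDegree_C, zero_add]
  exact hN k' k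

theorem exists_forall_epsPow_mul_mul_epsPow_mem_epsBigO {ι : Type*} [Finite ι] {w : ι → ℕ}
    {N : Matrix ι ι (MvPolynomial σ F⸨X⸩)} (hN : ∀ i j, N i j ≠ 0 → w i < w j) (M : ℕ) :
    ∃ G₀ : ℕ, ∀ G ≥ G₀, ∀ i j,
      epsPow (-(G * w i : ℕ)) * N i j * epsPow (G * w j : ℕ) ∈ epsBigO M := by
  obtain ⟨D, hD⟩ := exists_forall_mem_epsBigO_neg (Function.uncurry N)
  refine ⟨D + M, fun G hG i j => ?_⟩
  by_cases hij : N i j = 0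
  · rw [hij, mul_zero, zero_mul]
    exact zero_mem _
  have hw : G * w i + G ≤ G * w j := Nat.mul_le_mul_left G (hN i j hij)
  refine epsBigO_anti (j := M) (k := -(G * w i : ℕ) + -D + (G * w j : ℕ)) (by omega) ?_
  exact mul_mem_epsBigO (mul_mem_epsBigO (epsPow_mem_epsBigO _) (hD (i, j)))
    (epsPow_mem_epsBigO _)

theorem exists_scaled_factorization {n : ℕ} {w : Fin n → ℕ} (hw : StrictMono w)
    {A : Matrix (Fin n) (Fin n) (MvPolynomial σ F⸨X⸩)} {o p : Fin n}
    {q : Fin n → MvPolynomial σ F⸨X⸩} (hA : ∀ i j, A i j ≠ 0 → i < j)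
    (hqA : Matrix.vecMul q (1 - A) = Pi.single o 1) (hq : ∀ j, p < j → q j = 0) (M : ℕ) :
    ∃ G ≥ M, ∃ L U : Matrix (Fin n) (Fin n) (MvPolynomial σ F⸨X⸩),
      (∀ i j, (L - 1) i j ∈ epsBigO M) ∧ (∀ i j, (U - 1) i j ∈ epsBigO M) ∧
      L * Matrix.diagonal (fun i => epsPow (2 * G * w i : ℕ) *
          Function.update (1 : Fin n → MvPolynomial σ F⸨X⸩) p (1 + epsPow 1 * q p) i) * U =
        Matrix.diagonal (fun i => epsPow (G * w i : ℕ)) * (1 - A + Matrix.single p o (epsPow 1)) *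
          Matrix.diagonal (fun i => epsPow (G * w i : ℕ)) := by
  obtain ⟨E, hE, hfactor⟩ := exists_one_add_mul_diagonal_mul_one_sub_eq hqA hq (epsPow 1)
  obtain ⟨G₁, hG₁⟩ := exists_forall_epsPow_mul_mul_epsPow_mem_epsBigO (N := E.transpose)
    (fun i j hij => hw (hE j i hij)) M
  obtain ⟨G₂, hG₂⟩ := exists_forall_epsPow_mul_mul_epsPow_mem_epsBigO
    (fun i j hij => hw (hA i j hij)) M
  let G := max M (max G₁ G₂)
  let D : Matrix (Fin n) (Fin n) (MvPolynomial σ F⸨X⸩) :=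
    Matrix.diagonal fun i => epsPow (G * w i : ℕ)
  let D' : Matrix (Fin n) (Fin n) (MvPolynomial σ F⸨X⸩) :=
    Matrix.diagonal fun i => epsPow (-(G * w i : ℕ))
  let Δ : Matrix (Fin n) (Fin n) (MvPolynomial σ F⸨X⸩) :=
    Matrix.diagonal (Function.update 1 p (1 + epsPow 1 * q p))
  have hD' : D' * D = 1 := by
    simp only [D, D', Matrix.diagonal_mul_diagonal, ← epsPow_add, neg_add_cancel, epsPow_zero,
      Matrix.diagonal_one]
  have hD : D * D' = 1 := mul_eq_one_comm.1 hD'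
  refine ⟨G, le_max_left _ _, D * (1 + E) * D', D' * (1 - A) * D, fun i j => ?_, fun i j => ?_, ?_⟩
  · have hsub : D * (1 + E) * D' - 1 = D * E * D' := by
      rw [mul_add, mul_one, add_mul, hD, add_sub_cancel_left]
    have hcomm : (D * E * D') i j = (D' * E.transpose * D) j i := by
      rw [Matrix.mul_diagonal, Matrix.diagonal_mul, Matrix.mul_diagonal, Matrix.diagonal_mul,
        Matrix.transpose_apply]
      ring
    rw [hsub, hcomm, Matrix.mul_diagonal, Matrix.diagonal_mul]
    exact hG₁ G (by omega) j i
  · have hsub : D' * (1 - A) * D - 1 = -(D' * A * D) := by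
      rw [mul_sub, mul_one, sub_mul, hD', sub_sub_cancel_left]
    rw [hsub, Matrix.neg_apply, Matrix.mul_diagonal, Matrix.diagonal_mul]
    exact neg_mem (hG₂ G (by omega) i j)
  · have hdiag : Matrix.diagonal (fun i => epsPow (2 * G * w i : ℕ) *
        Function.update (1 : Fin n → MvPolynomial σ F⸨X⸩) p (1 + epsPow 1 * q p) i) =
          D * Δ * D := by
      simp only [D, Δ, Matrix.diagonal_mul_diagonal, mul_right_comm (epsPow _), ← epsPow_add,
        two_mul, add_mul, Nat.cast_add]
    calc _ = D * (1 + E) * (D' * D) * Δ * (D * D') * (1 - A) * D := by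
          rw [hdiag]
          simp only [mul_assoc]
      _ = D * ((1 + E) * Δ * (1 - A)) * D := by
          rw [hD, hD', mul_one, mul_one]
          simp only [mul_assoc]
      _ = _ := by rw [hfactor]

end Factorization

section LeadingTerm

theorem exists_strictMono_injOn_weight {n : ℕ} (s : Finset (Fin n →₀ ℕ)) :
    ∃ w : Fin n → ℕ, StrictMono w ∧ Set.InjOn (Finsupp.weight w) (s : Set (Fin n →₀ ℕ)) := by
  let b := (s.sup fun α => Finset.univ.sup α) + 2
  have hb : 1 < b := by omega
  have hlt (α) (hα : α ∈ s) (i : Fin n) : α i < b := by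
    have h₁ : Finset.univ.sup α ≤ s.sup fun α => Finset.univ.sup α :=
      Finset.le_sup (f := fun α : Fin n →₀ ℕ => Finset.univ.sup α) hα
    have h₂ : α i ≤ Finset.univ.sup α := Finset.le_sup (Finset.mem_univ i)
    omega
  refine ⟨fun i => b ^ (i : ℕ), fun i j hij => Nat.pow_lt_pow_right hb hij, ?_⟩
  -- The weight of `α` is the number with the base-`b` digits `α 0, α 1, …`.
  intro α hα β hβ hαβ
  refine DFunLike.coe_injective (List.ofFn_injective (Nat.ofDigits_inj_of_len_eq hb ?_ ?_ ?_ ?_))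
  · rw [List.length_ofFn, List.length_ofFn]
  · simpa only [List.forall_mem_ofFn_iff] using hlt α hα
  · simpa only [List.forall_mem_ofFn_iff] using hlt β hβ
  · simp only [Nat.ofDigits_eq_sum_mapIdx, List.mapIdx_eq_ofFn, List.get_ofFn, List.length_ofFn,
      Fin.val_cast, List.sum_ofFn]
    rw [Finsupp.weight_eq_sum, Finsupp.weight_eq_sum] at hαβ
    exact hαβ

theorem exists_strictMono_forall_weight_lt {n : ℕ} {s : Finset (Fin n →₀ ℕ)} (hs : s.Nonempty) :
    ∃ w : Fin n → ℕ, StrictMono w ∧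
      ∃ α₀ ∈ s, ∀ α ∈ s, α ≠ α₀ → Finsupp.weight w α₀ < Finsupp.weight w α := by
  obtain ⟨w, hw, hinj⟩ := exists_strictMono_injOn_weight s
  obtain ⟨α₀, hα₀, hmin⟩ := s.exists_min_image (Finsupp.weight w) hs
  exact ⟨w, hw, α₀, hα₀, fun α hα hne =>
    (hmin α hα).lt_of_ne fun heq => hne (hinj hα₀ hα heq).symm⟩

theorem exists_mem_card_le_add_one {n : ℕ} {J : Finset (Fin n)} (hJ : J.Nonempty) :
    ∃ p ∈ J, J.card ≤ p + 1 := by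
  refine ⟨J.max' hJ, J.max'_mem hJ, ?_⟩
  rw [← Fin.card_Iic]
  exact Finset.card_le_card fun i hi => Finset.mem_Iic.2 (J.le_max' i hi)

variable {F σ : Type*} [Field F]

theorem eval₂_epsPow_mul_monomial {R ι : Type*} [CommSemiring R]
    (φ : R →+* MvPolynomial σ F⸨X⸩) (u : ι → MvPolynomial σ F⸨X⸩) (w : ι → ℕ) (G : ℕ)
    (α : ι →₀ ℕ) (a : R) :
    eval₂ φ (fun i => epsPow (G * w i : ℕ) * u i) (monomial α a) =
      epsPow (G * Finsupp.weight w α : ℕ) * eval₂ φ u (monomial α a) := by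
  simp only [eval₂_monomial, mul_pow, Finsupp.prod_mul, ← epsPow_mul_natCast]
  rw [Finsupp.prod, ← epsPow_sum, mul_left_comm, Finsupp.weight_apply, Finsupp.sum, Finset.mul_sum]
  push_cast [smul_eq_mul]
  simp only [mul_assoc, mul_comm (α _ : ℤ)]

theorem eval₂_sub_min_weight_mem_epsBigO {R ι : Type*} [CommSemiring R]
    {φ : R →+* MvPolynomial σ F⸨X⸩} (hφ : ∀ a, φ a ∈ epsBigO 0) {u : ι → MvPolynomial σ F⸨X⸩}
    (hu : ∀ i, u i ∈ epsBigO 0) {P : MvPolynomial ι R} {w : ι → ℕ} {α₀ : ι →₀ ℕ}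
    (hα₀ : α₀ ∈ P.support)
    (hmin : ∀ α ∈ P.support, α ≠ α₀ → Finsupp.weight w α₀ < Finsupp.weight w α) (G : ℕ) :
    eval₂ φ (fun i => epsPow (G * w i : ℕ) * u i) P -
      epsPow (G * Finsupp.weight w α₀ : ℕ) * eval₂ φ u (monomial α₀ (P.coeff α₀)) ∈
        epsBigO (G * Finsupp.weight w α₀ + G : ℕ) := by
  classical
  nth_rw 1 [P.as_sum]
  rw [eval₂_sum, ← eval₂_epsPow_mul_monomial, ← Finset.sum_erase_eq_sub hα₀]
  refine sum_mem fun α hα => ?_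
  obtain ⟨hne, hα⟩ := Finset.mem_erase.1 hα
  have hweight : G * Finsupp.weight w α₀ + G ≤ G * Finsupp.weight w α :=
    Nat.mul_le_mul_left G (hmin α hα hne)
  rw [eval₂_epsPow_mul_monomial]
  refine epsBigO_anti (Int.ofNat_le.2 hweight) ?_
  simpa only [add_zero] using
    mul_mem_epsBigO (epsPow_mem_epsBigO _) (eval₂_mem_epsBigO_zero hφ hu _)

theorem aeval_mul_diagonal_mul_sub_mem_epsBigO {ι κ μ : Type*} [Fintype κ] [DecidableEq κ]
    {A A₀ : Matrix ι κ (MvPolynomial σ F⸨X⸩)} {B B₀ : Matrix κ μ (MvPolynomial σ F⸨X⸩)} {G M : ℕ}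
    (hA₀ : ∀ i k, A₀ i k ∈ epsBigO 0) (hB₀ : ∀ k j, B₀ k j ∈ epsBigO 0)
    (hA : ∀ i k, (A - A₀) i k ∈ epsBigO M) (hB : ∀ k j, (B - B₀) k j ∈ epsBigO M) (hMG : M ≤ G)
    {u : κ → MvPolynomial σ F⸨X⸩} (hu : ∀ k, u k ∈ epsBigO 0) {f : MvPolynomial (ι × μ) F}
    {w : κ → ℕ} {α₀ : κ →₀ ℕ} (hα₀ : α₀ ∈ (genericDiag κ f).support)
    (hmin : ∀ α ∈ (genericDiag κ f).support, α ≠ α₀ →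
      Finsupp.weight w α₀ < Finsupp.weight w α) :
    aeval (fun x => (A * Matrix.diagonal (fun i : κ => epsPow (G * w i : ℕ) * u i) * B :
        Matrix ι μ _) x.1 x.2) f -
      epsPow (G * Finsupp.weight w α₀ : ℕ) *
        (aeval (Sum.elim (Function.uncurry A₀) (Function.uncurry B₀))
          (coeff α₀ (genericDiag κ f)) * α₀.prod fun k e => u k ^ e) ∈
        epsBigO (G * Finsupp.weight w α₀ + M : ℕ) := by
  have hclose (x) : Sum.elim (Function.uncurry A) (Function.uncurry B) x -
      Sum.elim (Function.uncurry A₀) (Function.uncurry B₀) x ∈ epsBigO (σ := σ) (F := F) M := by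
    rcases x with ⟨i, k⟩ | ⟨k, j⟩
    exacts [hA i k, hB k j]
  have h₀ (x) : Sum.elim (Function.uncurry A₀) (Function.uncurry B₀) x ∈
      epsBigO (σ := σ) (F := F) 0 := by
    rcases x with ⟨i, k⟩ | ⟨k, j⟩
    exacts [hA₀ i k, hB₀ k j]
  have h₁ (x) : Sum.elim (Function.uncurry A) (Function.uncurry B) x ∈
      epsBigO (σ := σ) (F := F) 0 :=
    mem_epsBigO_zero_of_sub_mem (h₀ x) (hclose x)
  have hprod : (α₀.prod fun k e => u k ^ e) ∈ epsBigO 0 := by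
    simpa only [eval₂_monomial, map_one, one_mul] using
      eval₂_mem_epsBigO_zero map_ofPowerSeries_mem_epsBigO_zero hu (monomial α₀ 1)
  rw [← eval₂_genericDiag]
  have hlead := eval₂_sub_min_weight_mem_epsBigO
    (φ := (aeval (R := F) (Sum.elim (Function.uncurry A) (Function.uncurry B))).toRingHom)
    (fun c => aeval_mem_epsBigO_zero h₁ c) hu hα₀ hmin G
  have hcoeff := mul_mem_epsBigO (epsPow_mem_epsBigO (G * Finsupp.weight w α₀ : ℕ))
    (mul_mem_epsBigO (aeval_sub_aeval_mem_epsBigO h₁ h₀ hclose (coeff α₀ (genericDiag κ f))) hprod)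
  rw [eval₂_monomial] at hlead
  refine (congrArg (· ∈ _) ?_).mp (add_mem (epsBigO_anti ?_ hlead) (epsBigO_anti ?_ hcoeff))
  · simp only [AlgHom.toRingHom_eq_coe, RingHom.coe_coe]
    ring
  · omega
  · omega

end LeadingTerm

section Degeneration

theorem exists_aeval_polynomial_ne_zero {R τ : Type*} [CommRing R] [IsDomain R]
    {c : MvPolynomial τ R} (hc : c ≠ 0) : ∃ θ : τ → Polynomial R, aeval θ c ≠ 0 := by
  by_contra! h
  refine hc (map_injective (Polynomial.C : R →+* _) Polynomial.C_injective ?_)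
  rw [map_zero]
  refine MvPolynomial.funext fun θ => ?_
  rw [map_zero, eval_map]
  exact h θ

theorem prod_update_one_pow {ι S : Type*} [DecidableEq ι] [CommSemiring S] (p : ι) (x : S)
    (α : ι →₀ ℕ) : (α.prod fun i e => Function.update (1 : ι → S) p x i ^ e) = x ^ α p := by
  rw [Finsupp.prod_eq_single p, Function.update_self]
  · intro i _ hi
    rw [Function.update_of_ne hi, Pi.one_apply, one_pow]
  · exact fun _ => pow_zero _

variable {F σ : Type*} [Field F]

theorem algebraMap_ratFunc_C (a : F) :
    algebraMap (RatFunc F) F⸨X⸩ (RatFunc.C a) = algebraMap F F⸨X⸩ a := by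
  rw [← RatFunc.algebraMap_C, ← IsScalarTower.algebraMap_apply]
  exact congrArg (HahnSeries.ofPowerSeries ℤ F) (Polynomial.coe_C a)

theorem aeval_epsPow_one_eq_C (P : Polynomial F) :
    Polynomial.aeval (epsPow 1 : MvPolynomial σ F⸨X⸩) P =
      C (algebraMap (RatFunc F) F⸨X⸩ (algebraMap (Polynomial F) (RatFunc F) P)) := by
  induction P using Polynomial.induction_on' with
  | add P Q hP hQ => simp only [map_add, hP, hQ]
  | monomial n a =>
    rw [← Polynomial.C_mul_X_pow_eq_monomial]
    simp only [map_mul, map_pow, Polynomial.aeval_X, Polynomial.aeval_C, RatFunc.algebraMap_X,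
      RatFunc.coe_X, epsPow, RatFunc.algebraMap_C, algebraMap_ratFunc_C,
      MvPolynomial.algebraMap_apply]

theorem aeval_epsPow_one_mem_epsBigO_zero (P : Polynomial F) :
    Polynomial.aeval (epsPow 1 : MvPolynomial σ F⸨X⸩) P ∈ epsBigO 0 := by
  rw [aeval_epsPow_one_eq_C, ← IsScalarTower.algebraMap_apply]
  exact map_C (σ := σ) (HahnSeries.ofPowerSeries ℤ F) (P : F⟦X⟧) ▸
    map_ofPowerSeries_mem_epsBigO_zero _

theorem totalDegree_one_sub_add_single_apply_le {R ι : Type*} [CommRing R] [DecidableEq ι]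
    {A : Matrix ι ι (MvPolynomial σ R)} (hA : ∀ i j, (A i j).totalDegree ≤ 1) (p o : ι) (c : R)
    (i j : ι) : ((1 - A + Matrix.single p o (C c) : Matrix ι ι _) i j).totalDegree ≤ 1 := by
  rw [Matrix.add_apply, Matrix.sub_apply, Matrix.one_apply, Matrix.single_apply]
  refine (totalDegree_add _ _).trans (max_le ((totalDegree_sub _ _).trans (max_le ?_ (hA i j))) ?_)
  · split_ifs <;> simp
  · split_ifs <;> simp

theorem exists_affine_matrix_eq_mul_diagonal_mul {n : ℕ} {ι μ : Type*} {w : Fin n → ℕ}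
    (hw : StrictMono w) {A : Matrix (Fin n) (Fin n) (MvPolynomial σ F⸨X⸩)} {o p : Fin n}
    {q : Fin n → MvPolynomial σ F⸨X⸩} (hA : ∀ i j, A i j ≠ 0 → i < j)
    (hAdeg : ∀ i j, (A i j).totalDegree ≤ 1) (hqA : Matrix.vecMul q (1 - A) = Pi.single o 1)
    (hq : ∀ j, p < j → q j = 0) {a : Matrix ι (Fin n) F⸨X⸩} {b : Matrix (Fin n) μ F⸨X⸩}
    (ha : ∀ i k, C (a i k) ∈ epsBigO (σ := σ) 0) (hb : ∀ k j, C (b k j) ∈ epsBigO (σ := σ) 0)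
    (M : ℕ) :
    ∃ G ≥ M, ∃ (A' : Matrix ι (Fin n) (MvPolynomial σ F⸨X⸩))
      (B' : Matrix (Fin n) μ (MvPolynomial σ F⸨X⸩)),
      (∀ i k, A' i k - C (a i k) ∈ epsBigO M) ∧ (∀ k j, B' k j - C (b k j) ∈ epsBigO M) ∧
      ∀ i j, ((A' * Matrix.diagonal (fun i : Fin n => epsPow (2 * G * w i : ℕ) *
          Function.update (1 : Fin n → MvPolynomial σ F⸨X⸩) p (1 + epsPow 1 * q p) i) * B' :
            Matrix ι μ _) i j).totalDegree ≤ 1 := by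
  obtain ⟨G, hMG, L, U, hL, hU, hLU⟩ := exists_scaled_factorization hw hA hqA hq M
  let d : Matrix (Fin n) (Fin n) F⸨X⸩ :=
    Matrix.diagonal fun i => HahnSeries.single ((G * w i : ℕ) : ℤ) 1
  have hd : d.map (C (σ := σ)) = Matrix.diagonal (fun i : Fin n => epsPow (G * w i : ℕ)) :=
    Matrix.diagonal_map (map_zero _)
  let a' : Matrix ι (Fin n) (MvPolynomial σ F⸨X⸩) := a.map C
  let b' : Matrix (Fin n) μ (MvPolynomial σ F⸨X⸩) := b.map C
  refine ⟨G, hMG, a' * L, U * b', fun i k => ?_, fun k j => ?_, fun i j => ?_⟩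
  · have hsub : a' * L - a' = a' * (L - 1) := by rw [Matrix.mul_sub, Matrix.mul_one]
    refine (congrArg (· ∈ _) (congrFun₂ hsub i k)).mpr ?_
    exact zero_add (M : ℤ) ▸ matrix_mul_apply_mem_epsBigO (A := a') ha hL i k
  · have hsub : U * b' - b' = (U - 1) * b' := by rw [Matrix.sub_mul, Matrix.one_mul]
    refine (congrArg (· ∈ _) (congrFun₂ hsub k j)).mpr ?_
    exact add_zero (M : ℤ) ▸ matrix_mul_apply_mem_epsBigO (B := b') hU hb k j
  · have hmul : a' * L * Matrix.diagonal (fun i : Fin n => epsPow (2 * G * w i : ℕ) *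
        Function.update (1 : Fin n → MvPolynomial σ F⸨X⸩) p (1 + epsPow 1 * q p) i) * (U * b') =
        (a * d).map (C (σ := σ)) * (1 - A + Matrix.single p o (epsPow 1)) *
          (d * b).map (C (σ := σ)) := by
      rw [Matrix.map_mul, Matrix.map_mul, hd, ← Matrix.mul_assoc, Matrix.mul_assoc a',
        Matrix.mul_assoc a', hLU]
      simp only [a', b', Matrix.mul_assoc]
    rw [hmul]
    exact totalDegree_map_C_mul_mul_map_C_apply_le _ _
      (totalDegree_one_sub_add_single_apply_le hAdeg p o _) i j

theorem mul_diagonal_mul_apply_mem_epsBigO_zero {ι κ μ : Type*} [Fintype κ] [DecidableEq κ]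
    {A : Matrix ι κ (MvPolynomial σ F⸨X⸩)} {B : Matrix κ μ (MvPolynomial σ F⸨X⸩)}
    {u : κ → MvPolynomial σ F⸨X⸩} (hA : ∀ i k, A i k ∈ epsBigO 0) (hu : ∀ k, u k ∈ epsBigO 0)
    (hB : ∀ k j, B k j ∈ epsBigO 0) (i : ι) (j : μ) :
    (A * Matrix.diagonal u * B : Matrix ι μ _) i j ∈ epsBigO 0 := by
  refine matrix_mul_apply_mem_epsBigO (j := 0) (k := 0) (fun i k => ?_) hB i j
  rw [Matrix.mul_diagonal]
  exact mul_mem_epsBigO (j := 0) (k := 0) (hA i k) (hu k)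

theorem exists_affine_aeval_sub_mem_epsBigO {n : ℕ} {ι μ : Type*} {w : Fin n → ℕ}
    (hw : StrictMono w) {A : Matrix (Fin n) (Fin n) (MvPolynomial σ F⸨X⸩)} {o p : Fin n}
    {q : Fin n → MvPolynomial σ F⸨X⸩} (hA : ∀ i j, A i j ≠ 0 → i < j)
    (hAdeg : ∀ i j, (A i j).totalDegree ≤ 1) (hqA : Matrix.vecMul q (1 - A) = Pi.single o 1)
    (hq : ∀ j, p < j → q j = 0) (hqp : q p ∈ epsBigO 0) {f : MvPolynomial (ι × μ) F}
    {α₀ : Fin n →₀ ℕ} (hα₀ : α₀ ∈ (genericDiag (Fin n) f).support)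
    (hmin : ∀ α ∈ (genericDiag (Fin n) f).support, α ≠ α₀ →
      Finsupp.weight w α₀ < Finsupp.weight w α) :
    ∃ γ : RatFunc F, γ ≠ 0 ∧ ∀ M : ℕ, ∃ (e : ℕ) (W : ι × μ → MvPolynomial σ F⸨X⸩),
      (∀ x, (W x).totalDegree ≤ 1) ∧ (∀ x, W x ∈ epsBigO 0) ∧
      aeval W f - epsPow e * (C (algebraMap (RatFunc F) F⸨X⸩ γ) * (1 + epsPow 1 * q p) ^ α₀ p) ∈
        epsBigO (e + M : ℕ) := by
  obtain ⟨θ, hθ⟩ := exists_aeval_polynomial_ne_zero (mem_support_iff.1 hα₀)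
  refine ⟨algebraMap _ _ (aeval θ (coeff α₀ (genericDiag (Fin n) f))),
    (map_ne_zero_iff _ (RatFunc.algebraMap_injective F)).2 hθ, fun M => ?_⟩
  let c (x) : F⸨X⸩ := algebraMap (RatFunc F) F⸨X⸩ (algebraMap (Polynomial F) (RatFunc F) (θ x))
  have hc (x) : C (c x) ∈ epsBigO (σ := σ) 0 :=
    aeval_epsPow_one_eq_C (σ := σ) (θ x) ▸ aeval_epsPow_one_mem_epsBigO_zero _
  obtain ⟨G, hMG, A', B', hA', hB', hdeg⟩ := exists_affine_matrix_eq_mul_diagonal_mul hw hA hAdeg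
    hqA hq (a := fun i k => c (.inl (i, k))) (b := fun k j => c (.inr (k, j)))
    (fun _ _ => hc _) (fun _ _ => hc _) M
  have hu (i : Fin n) :
      Function.update (1 : Fin n → MvPolynomial σ F⸨X⸩) p (1 + epsPow 1 * q p) i ∈ epsBigO 0 := by
    rcases eq_or_ne i p with rfl | hi
    · rw [Function.update_self]
      exact one_add_epsPow_one_mul_mem_epsBigO_zero hqp
    · rw [Function.update_of_ne hi]
      exact one_mem_epsBigO_zero
  refine ⟨2 * G * Finsupp.weight w α₀, _, fun x => hdeg x.1 x.2, fun x => ?_, ?_⟩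
  · refine mul_diagonal_mul_apply_mem_epsBigO_zero
      (fun i k => mem_epsBigO_zero_of_sub_mem (hc _) (hA' i k))
      (fun i => ?_) (fun k j => mem_epsBigO_zero_of_sub_mem (hc _) (hB' k j)) x.1 x.2
    exact epsBigO_anti (by omega) (mul_mem_epsBigO (epsPow_mem_epsBigO _) (hu i))
  · have hlead := aeval_mul_diagonal_mul_sub_mem_epsBigO (A₀ := fun i k => C (c (.inl (i, k))))
      (B₀ := fun k j => C (c (.inr (k, j)))) (fun _ _ => hc _) (fun _ _ => hc _) hA' hB'
      (hMG.trans (Nat.le_mul_of_pos_left G two_pos)) hu hα₀ hmin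
    have hθ : Sum.elim (Function.uncurry fun i k => C (c (.inl (i, k))))
        (Function.uncurry fun k j => C (c (.inr (k, j)))) =
        fun x => Polynomial.aeval (epsPow 1 : MvPolynomial σ F⸨X⸩) (θ x) := by
      funext x
      rw [aeval_epsPow_one_eq_C]
      rcases x with _ | _ <;> rfl
    rwa [prod_update_one_pow, hθ, ← comp_aeval_apply, aeval_epsPow_one_eq_C] at hlead

end Degeneration

section Extraction

theorem exists_one_add_pow_eq (F : Type*) {S : Type*} [Field F] [CommRing S] [Algebra F S] (q : ℕ)
    [ExpChar F q] {k : ℕ} (hk : k ≠ 0) :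
    ∃ a k' : ℕ, (k' : F) ≠ 0 ∧ ∀ x : S, ∃ z : S,
      (1 + x) ^ k = 1 + (k' : S) * x ^ q ^ a + x ^ (2 * q ^ a) * z := by
  obtain ⟨a, k', hk', rfl⟩ : ∃ a k' : ℕ, (k' : F) ≠ 0 ∧ k = q ^ a * k' := by
    rcases ‹ExpChar F q› with _ | hq
    · exact ⟨0, k, Nat.cast_ne_zero.2 hk, by rw [pow_zero, one_mul]⟩
    · obtain ⟨a, k', hdvd, rfl⟩ := Nat.exists_eq_pow_mul_and_not_dvd hk q hq.ne_one
      exact ⟨a, k', by rwa [Ne, CharP.cast_eq_zero_iff F q], rfl⟩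
  refine ⟨a, k', hk', fun x => ?_⟩
  rcases subsingleton_or_nontrivial S with _ | _
  · exact ⟨0, Subsingleton.elim _ _⟩
  have := expChar_of_injective_algebraMap (algebraMap F S).injective q
  obtain ⟨z, hz⟩ := Polynomial.powAddExpansion (1 : S) (x ^ q ^ a) k'
  refine ⟨z, ?_⟩
  rw [pow_mul, add_pow_expChar_pow, one_pow, hz]
  ring

variable {F σ : Type*} [Field F]

theorem C_algebraMap_X_zpow (k : ℤ) :
    C (algebraMap (RatFunc F) F⸨X⸩ (RatFunc.X ^ k)) = (epsPow k : MvPolynomial σ F⸨X⸩) := by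
  rw [map_zpow₀, RatFunc.coe_X, ← RatFunc.single_zpow, epsPow]

theorem exists_one_add_epsPow_mul_pow_sub_mem_epsBigO (F σ : Type*) [Field F] (q : ℕ)
    [ExpChar F q] {k : ℕ} (hk : k ≠ 0) :
    ∃ a k' : ℕ, (k' : F) ≠ 0 ∧ ∀ P ∈ epsBigO (F := F) (σ := σ) 0,
      (1 + epsPow 1 * P) ^ k - (1 + (k' : MvPolynomial σ F⸨X⸩) * epsPow (q ^ a : ℕ) * P ^ q ^ a) ∈
        epsBigO (q ^ a + 1 : ℕ) := by
  obtain ⟨a, k', hk', hexpand⟩ := exists_one_add_pow_eq F (S := MvPolynomial σ F⟦X⟧) q hk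
  refine ⟨a, k', hk', fun P hP => ?_⟩
  obtain ⟨P, rfl⟩ := mem_epsBigO.1 hP
  obtain ⟨z, hz⟩ := hexpand (C PowerSeries.X * P)
  have hexpand' := congrArg (map (HahnSeries.ofPowerSeries ℤ F)) hz
  have hε : map (HahnSeries.ofPowerSeries ℤ F) (C PowerSeries.X) =
      (epsPow 1 : MvPolynomial σ F⸨X⸩) := by
    rw [map_C, HahnSeries.ofPowerSeries_X, epsPow]
  have hεpow (i : ℕ) : (epsPow 1 : MvPolynomial σ F⸨X⸩) ^ i = epsPow i := by
    rw [← epsPow_mul_natCast, one_mul]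
  simp only [map_add, map_mul, map_pow, map_one, map_natCast, hε, mul_pow, hεpow] at hexpand'
  have hq : q ^ a + 1 ≤ 2 * q ^ a := by
    have := Nat.one_le_pow a q (expChar_pos F q)
    omega
  rw [epsPow_zero, one_mul, hexpand', mul_assoc (k' : MvPolynomial σ F⸨X⸩), add_sub_cancel_left]
  refine epsBigO_anti (Int.ofNat_le.2 hq) ?_
  rw [mul_assoc, ← map_pow, ← map_mul]
  exact mem_epsBigO.2 ⟨_, rfl⟩

theorem exists_borderComputes_one_add_pow_sub_one (F σ : Type*) [Field F] (q : ℕ) [ExpChar F q]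
    {k : ℕ} (hk : k ≠ 0) :
    ∃ (a : ℕ) (c : F), ∀ {P : MvPolynomial σ F⸨X⸩} {g : MvPolynomial σ F},
      P ∈ epsBigO 0 → BorderComputes P g →
      BorderComputes (epsPow (-(q ^ a : ℕ)) * C (algebraMap F F⸨X⸩ c) *
        ((1 + epsPow 1 * P) ^ k - 1)) (g ^ q ^ a) := by
  obtain ⟨a, k', hk', hexpand⟩ := exists_one_add_epsPow_mul_pow_sub_mem_epsBigO F σ q hk
  refine ⟨a, (k' : F)⁻¹, fun {P g} hP hPg => ?_⟩
  let κ : MvPolynomial σ F⸨X⸩ := C (algebraMap F F⸨X⸩ (k' : F)⁻¹)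
  have hκ : κ * k' = 1 := by
    rw [← map_natCast (C : F⸨X⸩ →+* MvPolynomial σ F⸨X⸩), ← map_natCast (algebraMap F F⸨X⸩),
      ← map_mul, ← map_mul, inv_mul_cancel₀ hk', map_one, map_one]
  have hε : (epsPow (-(q ^ a : ℕ)) * epsPow (q ^ a : ℕ) : MvPolynomial σ F⸨X⸩) = 1 := by
    rw [← epsPow_add, neg_add_cancel, epsPow_zero]
  have htail := mul_mem_epsBigO (mul_mem_epsBigO (epsPow_mem_epsBigO (-(q ^ a : ℕ)))
    (algebraMap_mem_epsBigO_zero (σ := σ) (k' : F)⁻¹)) (hexpand P hP)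
  have hg := pow_sub_pow_mem_epsBigO hP (map_algebraMap_mem_epsBigO_zero g)
    (borderComputes_iff.1 hPg) (q ^ a)
  rw [borderComputes_iff, map_pow]
  refine (congrArg (· ∈ _) ?_).mp (add_mem (epsBigO_anti (by omega) htail) hg)
  rw [MvPolynomial.algebraMap_apply]
  linear_combination -(κ * k' * P ^ q ^ a * hε) - P ^ q ^ a * hκ

theorem exists_borderComputes_pow_of_sub_mem (q : ℕ) [ExpChar F q] {γ : RatFunc F} (hγ : γ ≠ 0)
    {k : ℕ} (hk : k ≠ 0) {P : MvPolynomial σ F⸨X⸩} {g : MvPolynomial σ F}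
    (hP : P ∈ epsBigO 0) (hPg : BorderComputes P g) :
    ∃ a M : ℕ, ∀ e : ℕ, ∃ δ β : RatFunc F, ∀ Y : MvPolynomial σ F⸨X⸩,
      Y - epsPow e * (C (algebraMap (RatFunc F) F⸨X⸩ γ) * (1 + epsPow 1 * P) ^ k) ∈
          epsBigO (e + M : ℕ) →
        BorderComputes (C (algebraMap (RatFunc F) F⸨X⸩ δ) + C (algebraMap (RatFunc F) F⸨X⸩ β) * Y)
          (g ^ q ^ a) := by
  obtain ⟨a, c, hpow⟩ := exists_borderComputes_one_add_pow_sub_one F σ q hk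
  obtain ⟨D, hD⟩ := exists_mem_epsBigO_neg (C (σ := σ) (algebraMap (RatFunc F) F⸨X⸩ γ⁻¹))
  let Q := q ^ a
  refine ⟨a, D + Q + 1, fun e => ⟨-(RatFunc.X ^ (-Q : ℤ) * RatFunc.C c),
    RatFunc.X ^ (-(e + Q) : ℤ) * (γ⁻¹ * RatFunc.C c), fun Y hY => ?_⟩⟩
  have hγ_mul : C (σ := σ) (algebraMap (RatFunc F) F⸨X⸩ γ⁻¹) *
      C (algebraMap (RatFunc F) F⸨X⸩ γ) = 1 := by
    rw [← map_mul, ← map_mul, inv_mul_cancel₀ hγ, map_one, map_one]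
  have hε : (epsPow (-(e + Q)) * epsPow e : MvPolynomial σ F⸨X⸩) = epsPow (-Q) := by
    rw [← epsPow_add, neg_add_rev, neg_add_cancel_right]
  have hY' := mul_mem_epsBigO (mul_mem_epsBigO (epsPow_mem_epsBigO (-(e + Q)))
    (mul_mem_epsBigO hD (algebraMap_mem_epsBigO_zero c))) hY
  rw [borderComputes_iff]
  refine (congrArg (· ∈ _) ?_).mp
    (add_mem (epsBigO_anti (by omega) hY') (borderComputes_iff.1 (hpow hP hPg)))
  simp only [map_neg, map_mul, C_algebraMap_X_zpow, algebraMap_ratFunc_C,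
    MvPolynomial.algebraMap_apply]
  linear_combination -(C (algebraMap (RatFunc F) F⸨X⸩ γ⁻¹) * C (algebraMap (RatFunc F) F⸨X⸩ γ) *
    C (algebraMap F F⸨X⸩ c) * (1 + epsPow 1 * P) ^ k * hε) -
      epsPow (-Q) * C (algebraMap F F⸨X⸩ c) * (1 + epsPow 1 * P) ^ k * hγ_mul

end Extraction

section Substitution

variable {F σ : Type*} [Field F] {n m r : ℕ} {f : MvPolynomial (Fin n × Fin m) F}

theorem exists_aeval_sub_mem_epsBigO_of_mem_detIdeal (hf : f ∈ detIdeal F n m r) (hf0 : f ≠ 0)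
    {s : ℕ} (hs : s ≤ r) (B : LayeredABP F⸨X⸩ σ s) (hB : B.poly ∈ epsBigO 0) :
    ∃ γ : RatFunc F, γ ≠ 0 ∧ ∃ k ≠ 0, ∀ M : ℕ,
      ∃ (e : ℕ) (W : Fin n × Fin m → MvPolynomial σ F⸨X⸩),
        (∀ x, (W x).totalDegree ≤ 1) ∧ (∀ x, W x ∈ epsBigO 0) ∧
        aeval W f -
            epsPow e * (C (algebraMap (RatFunc F) F⸨X⸩ γ) * (1 + epsPow 1 * B.poly) ^ k) ∈
          epsBigO (e + M : ℕ) := by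
  obtain ⟨w, hw, α₀, hα₀, hmin⟩ := exists_strictMono_forall_weight_lt
    (support_nonempty.2 (genericDiag_ne_zero (κ := Fin n) hf0))
  have hcard := hs.trans (le_card_support_of_mem_support_genericDiag hf hα₀)
  obtain ⟨p, hp, hpcard⟩ := exists_mem_card_le_add_one
    (Finset.card_pos.1 (B.sink.pos.trans_le hcard))
  obtain ⟨A, o, q, hA, hAdeg, hqA, hqp, hq⟩ := B.exists_strictUpper (hcard.trans hpcard)
  obtain ⟨γ, hγ, hW⟩ := exists_affine_aeval_sub_mem_epsBigO hw hA hAdeg hqA hq (hqp ▸ hB) hα₀ hmin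
  exact ⟨γ, hγ, α₀ p, Finsupp.mem_support_iff.1 hp, hqp ▸ hW⟩

theorem exists_ratFunc_sub_eq (x : F⟦X⟧) (N : ℕ) :
    ∃ (y : RatFunc F) (z : F⟦X⟧), HahnSeries.ofPowerSeries ℤ F x - algebraMap (RatFunc F) F⸨X⸩ y =
      HahnSeries.single (N : ℤ) 1 * HahnSeries.ofPowerSeries ℤ F z := by
  obtain ⟨z, hz⟩ : PowerSeries.X ^ N ∣ x - (PowerSeries.trunc N x : F⟦X⟧) :=
    PowerSeries.X_pow_dvd_iff.2 fun k hk => by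
      rw [map_sub, Polynomial.coeff_coe, PowerSeries.coeff_trunc, if_pos hk, sub_self]
  refine ⟨PowerSeries.trunc N x, z, ?_⟩
  exact (congrArg (_ - ·) (RatFunc.coe_coe _)).symm.trans (by
    rw [← map_sub, hz, map_mul, HahnSeries.ofPowerSeries_X_pow])

theorem exists_ratFunc_sub_mem_epsBigO {P : MvPolynomial σ F⸨X⸩} (hP : P ∈ epsBigO 0) (N : ℕ) :
    ∃ ℓ : MvPolynomial σ (RatFunc F), ℓ.totalDegree ≤ P.totalDegree ∧
      P - map (algebraMap (RatFunc F) F⸨X⸩) ℓ ∈ epsBigO N := by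
  obtain ⟨Q, rfl⟩ := mem_epsBigO.1 hP
  rw [epsPow_zero, one_mul, totalDegree,
    support_map_of_injective Q HahnSeries.ofPowerSeries_injective, ← totalDegree]
  choose y z hyz using fun x : F⟦X⟧ => exists_ratFunc_sub_eq x N
  refine ⟨∑ α ∈ Q.support, monomial α (y (Q.coeff α)), ?_, ?_⟩
  · refine totalDegree_finsetSum_le fun α hα => ?_
    exact (totalDegree_monomial_le _ _).trans (le_totalDegree hα)
  · refine mem_epsBigO.2 ⟨∑ α ∈ Q.support, monomial α (z (Q.coeff α)), ?_⟩
    have hQ : map (HahnSeries.ofPowerSeries ℤ F) Q =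
        ∑ α ∈ Q.support, monomial α (HahnSeries.ofPowerSeries ℤ F (Q.coeff α)) := by
      nth_rw 1 [Q.as_sum]
      simp only [map_sum, map_monomial]
    simp only [hQ, map_sum, map_monomial, ← Finset.sum_sub_distrib, Finset.mul_sum, epsPow,
      C_mul_monomial, ← map_sub, hyz]

theorem exists_ratFunc_substitution (hf : f ∈ detIdeal F n m r) (hf0 : f ≠ 0)
    {g : MvPolynomial σ F} (hg : g ∈ borderABP F σ r) (q : ℕ) [ExpChar F q] :
    ∃ (a : ℕ) (δ β : RatFunc F) (ℓ : Fin n × Fin m → MvPolynomial σ (RatFunc F)),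
      (∀ x, (ℓ x).totalDegree ≤ 1) ∧
      (∀ x, map (algebraMap (RatFunc F) F⸨X⸩) (ℓ x) ∈ epsBigO 0) ∧ ∃ N ≠ 0, ∀ Y,
        Y - aeval (fun x => map (algebraMap (RatFunc F) F⸨X⸩) (ℓ x)) f ∈ epsBigO (N : ℕ) →
        BorderComputes (C (algebraMap (RatFunc F) F⸨X⸩ δ) + C (algebraMap (RatFunc F) F⸨X⸩ β) * Y)
          (g ^ q ^ a) := by
  obtain ⟨s, hs, B, hBg⟩ := hg
  have hB : B.poly ∈ epsBigO 0 := by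
    obtain ⟨H, hH, -⟩ := hBg
    exact hH ▸ map_ofPowerSeries_mem_epsBigO_zero H
  obtain ⟨γ, hγ, k, hk, hW⟩ := exists_aeval_sub_mem_epsBigO_of_mem_detIdeal hf hf0 hs B hB
  obtain ⟨a, M, hextract⟩ := exists_borderComputes_pow_of_sub_mem q hγ hk hB hBg
  obtain ⟨e, W, hWdeg, hW0, hWf⟩ := hW M
  obtain ⟨δ, β, hδβ⟩ := hextract e
  choose ℓ hℓdeg hℓ using fun x => exists_ratFunc_sub_mem_epsBigO (hW0 x) (e + M + 1)
  have hℓ0 (x) : map (algebraMap (RatFunc F) F⸨X⸩) (ℓ x) ∈ epsBigO 0 :=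
    mem_epsBigO_zero_of_sub_mem (hW0 x) (neg_sub (W x) _ ▸ neg_mem (hℓ x))
  refine ⟨a, δ, β, ℓ, fun x => (hℓdeg x).trans (hWdeg x), hℓ0, e + M + 1, Nat.succ_ne_zero _,
    fun Y hY => hδβ Y ?_⟩
  have hℓW := aeval_sub_aeval_mem_epsBigO hW0 hℓ0 hℓ f
  have hle : ((e + M : ℕ) : ℤ) ≤ (e + M + 1 : ℕ) := Int.ofNat_le.2 (Nat.le_succ _)
  simpa only [sub_add_sub_cancel, sub_sub_sub_cancel_left, sub_sub_eq_add_sub, sub_add_cancel] using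
    add_mem (sub_mem (epsBigO_anti hle hY) (epsBigO_anti hle hℓW)) hWf

theorem exists_substEpsPow_eq {κ : Type*} {h : MvPolynomial κ F⟦X⟧}
    {f : MvPolynomial κ F} (hhf : IsApprox h f) {N : ℕ} (hN : N ≠ 0) :
    ∃ e, substEpsPow N hN h = map (PowerSeries.C (R := F)) f + C (PowerSeries.X ^ N) * e := by
  obtain ⟨e, rfl⟩ := hhf
  have hC : (PowerSeries.expand N hN : F⟦X⟧ →ₐ[F] F⟦X⟧).toRingHom.comp (PowerSeries.C (R := F)) =
      PowerSeries.C (R := F) := RingHom.ext (PowerSeries.expand_C N hN)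
  have hX : (PowerSeries.expand N hN : F⟦X⟧ →ₐ[F] F⟦X⟧).toRingHom PowerSeries.X =
      PowerSeries.X ^ N := PowerSeries.expand_X N hN
  exact ⟨_, by rw [substEpsPow, map_add, map_mul, map_map, hC, map_C, hX]⟩

theorem bind₁_substEpsPow_sub_aeval_mem_epsBigO {κ : Type*} {h : MvPolynomial κ F⟦X⟧}
    {f : MvPolynomial κ F} (hhf : IsApprox h f) {N : ℕ} (hN : N ≠ 0)
    {W : κ → MvPolynomial σ F⸨X⸩} (hW : ∀ x, W x ∈ epsBigO 0) :
    bind₁ W (map (HahnSeries.ofPowerSeries ℤ F) (substEpsPow N hN h)) - aeval W f ∈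
      epsBigO N := by
  obtain ⟨e, he⟩ := exists_substEpsPow_eq hhf hN
  have hf : bind₁ W (map (HahnSeries.ofPowerSeries ℤ F) (map (PowerSeries.C (R := F)) f)) =
      aeval W f := by
    rw [map_ofPowerSeries_map_C]
    exact aeval_map_algebraMap _ _ _
  have he0 : bind₁ W (map (HahnSeries.ofPowerSeries ℤ F) e) ∈ epsBigO 0 := by
    rw [bind₁, aeval_def, eval₂_map]
    refine eval₂_mem_epsBigO_zero (fun a => ?_) hW e
    exact map_C (σ := σ) (HahnSeries.ofPowerSeries ℤ F) a ▸ map_ofPowerSeries_mem_epsBigO_zero (C a)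
  rw [he, map_add, map_add, hf, add_sub_cancel_left, map_mul, map_mul, map_C, bind₁_C_right,
    HahnSeries.ofPowerSeries_X_pow, ← add_zero (N : ℤ)]
  exact mul_mem_epsBigO (epsPow_mem_epsBigO N) he0

end Substitution

theorem eq_C_add_sum_of_totalDegree_le_one {R σ : Type*} [CommSemiring R] {P : MvPolynomial σ R}
    (hP : P.totalDegree ≤ 1) :
    P = C (P.coeff 0) + ∑ i ∈ P.vars, C (P.coeff (Finsupp.single i 1)) * X i := by
  classical
  ext α
  simp only [coeff_add, coeff_C, coeff_sum, coeff_C_mul, coeff_X, mul_ite, mul_one, mul_zero]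
  by_cases hα : α ∈ P.support
  · rcases Nat.le_one_iff_eq_zero_or_eq_one.1 ((le_totalDegree hα).trans hP) with h | h
    · obtain rfl : α = 0 := (Finsupp.degree_eq_zero_iff α).1 h
      simp
    · obtain ⟨i, rfl⟩ := (Finsupp.sum_eq_one_iff α).1 h
      have hi : i ∈ P.vars := (mem_vars_iff_mem_support i).2 ⟨_, hα, by simp⟩
      simp [Finsupp.single_left_inj, hi, eq_comm]
  · rw [notMem_support_iff] at hα
    rw [hα, Finset.sum_eq_zero, add_zero]
    · split_ifs with h
      · rw [h, hα]
      · rfl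
    · intro i _
      split_ifs with h
      · rw [h, hα]
      · rfl

namespace OracleCircuit

variable {K σ κ : Type*} [Field K] {b : ℕ}

/-- The circuit whose bottom gates compute the affine linear polynomials `ℓ i`, whose oracle gate
reads these through `e`, and whose output gate computes `c + d * y` from the value `y` of the
oracle gate. -/
noncomputable def sumOracleSum (ℓ : Fin b → MvPolynomial σ K) (e : κ → Fin b) (c d : K) :
    OracleCircuit K σ κ where
  size := b + 2
  gate := Fin.addCases
    (fun i => .add (coeff 0 (ℓ i)) ((ℓ i).vars.map .inl)
      (Sum.elim (fun x => coeff (.single x 1) (ℓ i)) 0))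
    fun
      | 0 => .oracle fun x => .inr (e x)
      | 1 => .add c {.inr (Fin.last b)} fun _ => d
  output := Fin.last (b + 1)

variable (ℓ : Fin b → MvPolynomial σ K) (e : κ → Fin b) (c d : K)

/-- The `i`-th addition gate in the bottom layer of `sumOracleSum ℓ e c d`. -/
def bottomGate (i : Fin b) : Fin (sumOracleSum ℓ e c d).size :=
  Fin.castAdd 2 i

/-- The oracle gate of `sumOracleSum ℓ e c d`. -/
def middleGate : Fin (sumOracleSum ℓ e c d).size :=
  Fin.natAdd b (0 : Fin 2)

/-- The output gate of `sumOracleSum ℓ e c d`. -/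
def topGate : Fin (sumOracleSum ℓ e c d).size :=
  Fin.natAdd b (1 : Fin 2)

variable {ℓ e c d} in
theorem forall_sumOracleSum_gate {P : Fin (sumOracleSum ℓ e c d).size → Prop} :
    (∀ i, P i) ↔ (∀ i, P (bottomGate ℓ e c d i)) ∧ P (middleGate ℓ e c d) ∧ P (topGate ℓ e c d) :=
  ⟨fun h => ⟨fun _ => h _, h _, h _⟩, fun h => Fin.addCases h.1 (Fin.forall_fin_two.2 h.2)⟩

theorem bottomGate_injective : Function.Injective (bottomGate ℓ e c d) :=
  Fin.castAdd_injective b 2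

theorem gate_bottomGate (i : Fin b) :
    (sumOracleSum ℓ e c d).gate (bottomGate ℓ e c d i) =
      .add (coeff 0 (ℓ i)) ((ℓ i).vars.map .inl)
        (Sum.elim (fun x => coeff (.single x 1) (ℓ i)) 0) := by
  simp only [sumOracleSum, bottomGate, Fin.addCases_left]
  rfl

theorem gate_middleGate :
    (sumOracleSum ℓ e c d).gate (middleGate ℓ e c d) = .oracle fun x => .inr (e x) := by
  simp only [sumOracleSum, middleGate, Fin.addCases_right]

theorem gate_topGate :
    (sumOracleSum ℓ e c d).gate (topGate ℓ e c d) = .add c {.inr (Fin.last b)} fun _ => d := by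
  simp only [sumOracleSum, topGate, Fin.addCases_right]
  rfl

section Level

variable [Fintype κ]

theorem gateLevel_bottomGate (i : Fin b) :
    (sumOracleSum ℓ e c d).gateLevel (bottomGate ℓ e c d i) = 1 := by
  rw [gateLevel, gate_bottomGate, OracleGate.level, Finset.sup_map]
  exact congrArg (· + 1) (Finset.sup_eq_bot_iff _ _ |>.2 fun _ _ => rfl)

theorem gateLevel_middleGate [Nonempty κ] :
    (sumOracleSum ℓ e c d).gateLevel (middleGate ℓ e c d) = 2 := by
  rw [gateLevel, gate_middleGate, OracleGate.level]
  refine congrArg (· + 1) ?_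
  exact (Finset.sup_congr rfl fun x _ => gateLevel_bottomGate ℓ e c d (e x)).trans
    (Finset.sup_const Finset.univ_nonempty 1)

theorem gateLevel_topGate [Nonempty κ] :
    (sumOracleSum ℓ e c d).gateLevel (topGate ℓ e c d) = 3 := by
  rw [gateLevel, gate_topGate, OracleGate.level, Finset.sup_singleton]
  exact congrArg (· + 1) (gateLevel_middleGate ℓ e c d)

theorem sumOracleSum_isLayered [Nonempty κ] : (sumOracleSum ℓ e c d).IsLayered := by
  refine forall_sumOracleSum_gate.2 ⟨fun i w hw => ?_, fun w hw => ?_, fun w hw => ?_⟩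
  · rw [gate_bottomGate] at hw
    obtain ⟨x, -, rfl⟩ := Finset.mem_map.1 hw
    exact (gateLevel_bottomGate ℓ e c d i).symm
  · rw [gate_middleGate] at hw
    obtain ⟨x, rfl⟩ := hw
    rw [gateLevel_middleGate]
    exact congrArg (· + 1) (gateLevel_bottomGate ℓ e c d (e x))
  · rw [gate_topGate] at hw
    obtain rfl := Finset.mem_singleton.1 hw
    rw [gateLevel_topGate]
    exact congrArg (· + 1) (gateLevel_middleGate ℓ e c d)

theorem addGates_one_sumOracleSum [Nonempty κ] :
    (sumOracleSum ℓ e c d).addGates 1 = Set.range (bottomGate ℓ e c d) := by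
  refine Set.Subset.antisymm ?_ ?_
  · refine forall_sumOracleSum_gate.2 ⟨fun i _ => ⟨i, rfl⟩, fun h => ?_, fun h => ?_⟩
    · cases (gateLevel_middleGate ℓ e c d).symm.trans h.2
    · cases (gateLevel_topGate ℓ e c d).symm.trans h.2
  · rintro _ ⟨i, rfl⟩
    refine ⟨?_, gateLevel_bottomGate ℓ e c d i⟩
    rw [gate_bottomGate]
    trivial

theorem oracleGates_two_sumOracleSum [Nonempty κ] :
    (sumOracleSum ℓ e c d).oracleGates 2 = {middleGate ℓ e c d} := by
  refine Set.Subset.antisymm ?_ ?_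
  · refine forall_sumOracleSum_gate.2 ⟨fun i h => ?_, fun _ => rfl, fun h => ?_⟩
    · cases (gateLevel_bottomGate ℓ e c d i).symm.trans h.2
    · cases (gateLevel_topGate ℓ e c d).symm.trans h.2
  · rintro _ rfl
    refine ⟨?_, gateLevel_middleGate ℓ e c d⟩
    rw [gate_middleGate]
    trivial

theorem addGates_three_sumOracleSum [Nonempty κ] :
    (sumOracleSum ℓ e c d).addGates 3 = {topGate ℓ e c d} := by
  refine Set.Subset.antisymm ?_ ?_
  · refine forall_sumOracleSum_gate.2 ⟨fun i h => ?_, fun h => ?_, fun _ => rfl⟩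
    · cases (gateLevel_bottomGate ℓ e c d i).symm.trans h.2
    · cases (gateLevel_middleGate ℓ e c d).symm.trans h.2
  · rintro _ rfl
    refine ⟨?_, gateLevel_topGate ℓ e c d⟩
    rw [gate_topGate]
    trivial

theorem isSumOracleSum_sumOracleSum [Nonempty κ] : (sumOracleSum ℓ e c d).IsSumOracleSum b := by
  refine ⟨sumOracleSum_isLayered ℓ e c d, gateLevel_topGate ℓ e c d, rfl, ?_, ?_, ?_⟩
  · rw [addGates_one_sumOracleSum, ← Set.image_univ,
      Set.ncard_image_of_injective _ (bottomGate_injective ℓ e c d), Set.ncard_univ, Nat.card_fin]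
  · rw [oracleGates_two_sumOracleSum, Set.ncard_singleton]
  · rw [addGates_three_sumOracleSum, Set.ncard_singleton]

end Level

variable {L : Type*} [Field L] [Algebra K L] (h : MvPolynomial κ L)

theorem gateValue_bottomGate {i : Fin b} (hi : (ℓ i).totalDegree ≤ 1) :
    (sumOracleSum ℓ e c d).gateValue h (bottomGate ℓ e c d i) = map (algebraMap K L) (ℓ i) := by
  rw [gateValue, gate_bottomGate, OracleGate.value, Finset.sum_map]
  conv_rhs => rw [eq_C_add_sum_of_totalDegree_le_one hi]
  simp only [map_add, map_sum, map_mul, map_C, map_X]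
  rfl

theorem poly_sumOracleSum (hℓ : ∀ i, (ℓ i).totalDegree ≤ 1) :
    (sumOracleSum ℓ e c d).poly h = C (algebraMap K L c) + C (algebraMap K L d) *
      bind₁ (fun x => map (algebraMap K L) (ℓ (e x))) h := by
  have horacle : (sumOracleSum ℓ e c d).gateValue h (middleGate ℓ e c d) =
      bind₁ (fun x => map (algebraMap K L) (ℓ (e x))) h := by
    rw [gateValue, gate_middleGate, OracleGate.value]
    exact congrArg (bind₁ · h) (funext fun x => gateValue_bottomGate ℓ e c d h (hℓ (e x)))
  have houtput : (sumOracleSum ℓ e c d).output = topGate ℓ e c d := rfl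
  rw [poly, houtput, gateValue, gate_topGate, OracleGate.value,
    Finset.sum_singleton, ← horacle]
  rfl

end OracleCircuit

theorem exists_isSumOracleSum_borderComputes_pow {F σ : Type*} [Field F] {n m r : ℕ}
    {f : MvPolynomial (Fin n × Fin m) F} (hf : f ∈ detIdeal F n m r) (hf0 : f ≠ 0)
    {h : MvPolynomial (Fin n × Fin m) F⟦X⟧} (hh : IsApprox h f)
    {g : MvPolynomial σ F} (hg : g ∈ borderABP F σ r) (q : ℕ) [ExpChar F q] :
    ∃ (N : ℕ) (hN : N ≠ 0) (Φ : OracleCircuit (RatFunc F) σ (Fin n × Fin m)),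
      Φ.IsSumOracleSum (n * m) ∧ ∃ k, BorderComputes
        (Φ.poly (map (HahnSeries.ofPowerSeries ℤ F) (substEpsPow N hN h))) (g ^ q ^ k) := by
  obtain ⟨k, δ, β, ℓ, hℓdeg, hℓ0, N, hN, hcompute⟩ := exists_ratFunc_substitution hf hf0 hg q
  have : Nonempty (Fin n × Fin m) := by
    obtain ⟨s, hs, B, -⟩ := hg
    exact nonempty_of_mem_detIdeal hf hf0 (B.sink.pos.trans_le hs)
  refine ⟨N, hN, .sumOracleSum (ℓ ∘ finProdFinEquiv.symm) finProdFinEquiv δ β,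
    OracleCircuit.isSumOracleSum_sumOracleSum .., k, ?_⟩
  rw [OracleCircuit.poly_sumOracleSum (ℓ ∘ _) _ _ _ _ fun _ => hℓdeg _]
  simp only [Function.comp_apply, Equiv.symm_apply_apply]
  exact hcompute _ (bind₁_substEpsPow_sub_aeval_mem_epsBigO hh hN hℓ0)

theorem mainTheorem1_general {F σ : Type*} [Field F] {n m r : ℕ}
    {f : MvPolynomial (Fin n × Fin m) F} (hf : f ∈ detIdeal F n m r) (hf0 : f ≠ 0)
    {h : MvPolynomial (Fin n × Fin m) F⟦X⟧} (hh : IsApprox h f)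
    {g : MvPolynomial σ F} (hg : g ∈ borderABP F σ r) :
    ∃ (N : ℕ) (hN : N ≠ 0) (Φ : OracleCircuit (RatFunc F) σ (Fin n × Fin m)),
      Φ.IsSumOracleSum (n * m) ∧
      (CharZero F →
        BorderComputes (Φ.poly (map (HahnSeries.ofPowerSeries ℤ F) (substEpsPow N hN h))) g) ∧
      (∀ p : ℕ, 0 < p → CharP F p → ∃ k : ℕ,
        BorderComputes (Φ.poly (map (HahnSeries.ofPowerSeries ℤ F) (substEpsPow N hN h)))
          (g ^ p ^ k)) := by
  obtain ⟨q, hq⟩ := ExpChar.exists F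
  obtain ⟨N, hN, Φ, hΦ, k, hcompute⟩ := exists_isSumOracleSum_borderComputes_pow hf hf0 hh hg q
  refine ⟨N, hN, Φ, hΦ, fun _ => ?_, fun p hp _ => ⟨k, ?_⟩⟩
  · obtain rfl : q = 1 := ExpChar.eq hq inferInstance
    rwa [one_pow, pow_one] at hcompute
  · have : NeZero p := ⟨hp.ne'⟩
    have : Fact p.Prime := ⟨(CharP.char_is_prime_of_pos F p).out⟩
    rwa [ExpChar.eq hq (inferInstance : ExpChar F p)] at hcompute

theorem mainTheorem1 {F : Type*} [Field F] (n m r l : ℕ)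
    (f : MvPolynomial (Fin n × Fin m) F) (hf : f ∈ detIdeal F n m r) (hf0 : f ≠ 0)
    (h : MvPolynomial (Fin n × Fin m) F⟦X⟧) (hh : IsApprox h f)
    (g : MvPolynomial (Fin l) F) (hg : g ∈ borderABP F (Fin l) r) :
    ∃ (N : ℕ) (hN : N ≠ 0) (Φ : OracleCircuit (RatFunc F) (Fin l) (Fin n × Fin m)),
      Φ.IsSumOracleSum (n * m) ∧
      (CharZero F →
        BorderComputes
          (Φ.poly (MvPolynomial.map (HahnSeries.ofPowerSeries ℤ F) (substEpsPow N hN h))) g) ∧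
      (∀ p : ℕ, 0 < p → CharP F p → ∃ k : ℕ,
        BorderComputes
          (Φ.poly (MvPolynomial.map (HahnSeries.ofPowerSeries ℤ F) (substEpsPow N hN h)))
          (g ^ p ^ k)) :=
  mainTheorem1_general hf hf0 hh hg
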